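/- Let $P\subset\mathbb{R}^2$ be a (convex) heptagon, i.e. a $2$-dimensional convex polytope with exactly $7$ vertices. A section of a polytope $Q\subset\mathbb{R}^d$ is its intersection with an affine subspace, where $P$ is regarded as a subset of $\mathbb{R}^d$ through an injective affine map $\mathbb{R}^2\to\mathbb{R}^d$. The intersection complexity $\mathrm{ic}(P)$ is the minimal number of vertices of a polytope (of any dimension) that has $P$ as a section; the extension complexity $\mathrm{ec}(P)$ is the minimal number of facets of a polytope $Q\subset\mathbb{R}^d$ ($d$ arbitrary) such that $P$ is the image of $Q$ under a linear map $\mathbb{R}^d\to\mathbb{R}^2$. Then $$\mathrm{ic}(P)=6\qquad\text{and}\qquad \mathrm{ec}(P)=6 .$$ More precisely, $P$ is a section of a $3$-dimensional polytope in $\mathbb{R}^3$ with at most $6$ vertices, and $P$ is not a section of any polytope, of any dimension, with at most $5$ vertices. -/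

import Mathlib

/-- A convex polytope in `ℝ^d`: the convex hull of a finite set of points. -/
def IsPolytope {d : ℕ} (Q : Set (EuclideanSpace ℝ (Fin d))) : Prop :=
  ∃ s : Set (EuclideanSpace ℝ (Fin d)), s.Finite ∧ Q = convexHull ℝ s

/-- The dimension of (the affine hull of) a nonempty set. -/
noncomputable def polyDim {d : ℕ} (Q : Set (EuclideanSpace ℝ (Fin d))) : ℕ :=
  Module.finrank ℝ (vectorSpan ℝ Q)

/-- The vertices of a polytope are its extreme points. -/
def vertexSet {d : ℕ} (Q : Set (EuclideanSpace ℝ (Fin d))) :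
    Set (EuclideanSpace ℝ (Fin d)) :=
  Q.extremePoints ℝ

/-- The facets of a polytope: its nonempty faces (sets of maximizers in `Q` of a linear
functional) of dimension `dim Q - 1`. -/
def facetSet {d : ℕ} (Q : Set (EuclideanSpace ℝ (Fin d))) :
    Set (Set (EuclideanSpace ℝ (Fin d))) :=
  {F | F.Nonempty ∧ IsExposed ℝ Q F ∧ polyDim F + 1 = polyDim Q}

/-- A convex `n`-gon: a two-dimensional polytope in the plane with exactly `n` vertices. -/
def IsNGon (n : ℕ) (P : Set (EuclideanSpace ℝ (Fin 2))) : Prop :=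
  IsPolytope P ∧ polyDim P = 2 ∧ (vertexSet P).encard = n

/-- `P ⊆ ℝ^k` is a section of `Q ⊆ ℝ^d`: after embedding `ℝ^k` affinely into `ℝ^d`, the set `P`
becomes the intersection of `Q` with an affine subspace. -/
def IsSectionOf {k d : ℕ} (P : Set (EuclideanSpace ℝ (Fin k)))
    (Q : Set (EuclideanSpace ℝ (Fin d))) : Prop :=
  ∃ (f : EuclideanSpace ℝ (Fin k) →ᵃ[ℝ] EuclideanSpace ℝ (Fin d))
    (H : AffineSubspace ℝ (EuclideanSpace ℝ (Fin d))),
    Function.Injective f ∧ f '' P = Q ∩ (H : Set (EuclideanSpace ℝ (Fin d)))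

/-- `Q ⊆ ℝ^d` is an extension of `P ⊆ ℝ^k`: `P` is the image of the polytope `Q` under a
linear map. -/
def IsExtensionOf {k d : ℕ} (Q : Set (EuclideanSpace ℝ (Fin d)))
    (P : Set (EuclideanSpace ℝ (Fin k))) : Prop :=
  IsPolytope Q ∧
    ∃ π : EuclideanSpace ℝ (Fin d) →ₗ[ℝ] EuclideanSpace ℝ (Fin k), π '' Q = P

/-- The intersection complexity of `P`: the minimal number of vertices of a polytope (of any
dimension) that has `P` as a section. -/
noncomputable def intersectionComplexity {k : ℕ} (P : Set (EuclideanSpace ℝ (Fin k))) : ℕ :=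
  sInf {m : ℕ | ∃ (d : ℕ) (Q : Set (EuclideanSpace ℝ (Fin d))),
    IsPolytope Q ∧ IsSectionOf P Q ∧ (vertexSet Q).encard = m}

/-- The extension complexity of `P`: the minimal number of facets of an extension of `P`. -/
noncomputable def extensionComplexity {k : ℕ} (P : Set (EuclideanSpace ℝ (Fin k))) : ℕ :=
  sInf {m : ℕ | ∃ (d : ℕ) (Q : Set (EuclideanSpace ℝ (Fin d))),
    IsExtensionOf Q P ∧ (facetSet Q).encard = m}

/-! Lower bound. Given a section of a polytope, label each vertex of the heptagon with the polytope
vertices occurring in some convex combination for it; given an extension, label it with the facets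
that miss a chosen lift. If every label of `p i` occurs at `p j` or `p (j + 1)`, the segment from `p
i` to the midpoint of that edge can be prolonged inside the polytope, hence inside the heptagon, so
`p i` is an end of the edge. Thus the labels `t` give combinatorial rectangles `{i | t ∈ A i} × {j |
t ∉ A j ∪ A (j + 1)}` that cover all pairs of a vertex and an edge not containing it. A finite
search, used in `exists_subset_union_of_card_le_five`, shows that five rectangles cannot do this.

Upper bound. Put three points above the plane and three below, with homogeneous coordinates `a i`
and `b j`, scaled so that the segment joining two of them meets the plane at the point represented
by `a i + b j`. It suffices that seven of the nine sums are positive multiples of the `(1, p k)` and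
the other two lie in the cone over the heptagon. Expressing `(1, p 0)` through `p 1, p 2, p 3` and
through `p 4, p 5, p 6` produces such an array. Its two extra entries lie in the cone once `p 0`
satisfies both pivot inequalities, and by Grassmann–Plücker relations some vertex of every heptagon
does (`exists_isLeftPivot_and_isRightPivot`).

The two complexities are linked by `IsSectionOf.exists_isExtensionOf`: the convex weights
representing points of a section form a slice of the nonnegative orthant, with at most one facet per
coordinate, and this slice projects onto the section. -/

/-! ### Rectangle covers of the slack pattern. -/

/-- Whether the bits of `u` can be covered by `n + 1` of the bit masks in `l`. -/
def coverable (l : List ℕ) : ℕ → ℕ → Bool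
  | 0, u => l.any fun r => Nat.beq (Nat.land u r) u
  | n + 1, u => Nat.beq u 0 || l.any fun r =>
      bif Nat.beq (Nat.land r (Nat.pow 2 (Nat.log2 u))) 0 then false
      else coverable l n (Nat.xor u (Nat.land u r))

/-- The maximal combinatorial rectangles in the support of the slack pattern of a heptagon, as bit
masks; the bit `7 * i + j` belongs to the vertex `i` and the edge from `j` to `j + 1`. -/
def slackRectangles : List ℕ :=
  [62, 7740, 15872, 924728, 1981440, 1982464, 101455920, 104857650, 236730368, 238829568,
   241172480, 8657571872, 9198108706, 9663681060, 10200547366, 25972715520, 26243252224,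
   26782728192, 26843558400, 27648851968, 2216338399232, 2250968678400, 2320228155392,
   2354715828736, 2458600341504, 2473902351360, 2508262096896, 2611340125696, 2714419331072,
   4432676798464, 8865353564162, 13298030346240, 17730698740228, 26596048109574, 31028722794496,
   35459250127880, 39891656392704, 53188874995212, 62053687492622, 66486093742080, 70368777996304,
   74766826618880, 79164874948626, 83562923556864, 105553116662808, 109951163187200,
   123145302314524, 131941395333150, 136339441844224]

/-- The support of the slack pattern of a heptagon, as a bit mask. -/
def slackSupport : ℕ :=
  Nat.ofBits (n := 49) fun k => decide (k.1 / 7 ≠ k.1 % 7) && decide (k.1 / 7 ≠ (k.1 % 7 + 1) % 7)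

/-- The rectangle spanned by the set of vertices with bit mask `m`. -/
def slackRectangle (m : ℕ) : ℕ :=
  Nat.ofBits (n := 49) fun k =>
    m.testBit (k.1 / 7) && !m.testBit (k.1 % 7) && !m.testBit ((k.1 % 7 + 1) % 7)

-- A rectangle is contained in the one with the same vertices and all edges compatible with them, so
-- running through the `2 ^ 7` vertex sets shows that the list dominates every rectangle.
set_option maxRecDepth 100000 in
theorem exists_slackRectangles_ge :
    ∀ m < 128, ∃ r ∈ slackRectangles, Nat.land (slackRectangle m) r = slackRectangle m := by
  decide +kernel


set_option maxRecDepth 100000 in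
theorem not_coverable_slackSupport : coverable slackRectangles 4 slackSupport = false := by
  decide +kernel

theorem Nat.testBit_log2_self {u : ℕ} (hu : u ≠ 0) : u.testBit u.log2 = true := by
  have h1 := Nat.log2_self_le hu
  have h2 := Nat.lt_log2_self (n := u)
  rw [Nat.testBit_eq_decide_div_mod_eq]
  have : u / 2 ^ u.log2 = 1 := by
    apply Nat.div_eq_of_lt_le <;> simp_all [pow_succ]; omega
  simp [this]

/-- The search may branch only on masks containing the highest uncovered bit, because any cover has
such a mask; erasing it leaves a cover of the remaining bits. -/
theorem coverable_of_cover {l : List ℕ} (n u : ℕ) (s : List ℕ) (hs : s ⊆ l)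
    (hlen : s.length = n + 1) (hcov : ∀ k, u.testBit k = true → ∃ r ∈ s, r.testBit k = true) :
    coverable l n u = true := by
  induction n generalizing u s with
  | zero =>
    obtain ⟨r, rfl⟩ := List.length_eq_one_iff.1 hlen
    simp only [coverable, List.any_eq_true]
    refine ⟨r, hs (by simp), ?_⟩
    rw [Nat.beq_eq]
    change u &&& r = u
    refine Nat.eq_of_testBit_eq fun k => ?_
    have := hcov k
    rw [Nat.testBit_and]
    cases h : u.testBit k <;> simp_all
  | succ n ih =>
    simp only [coverable, Bool.or_eq_true, List.any_eq_true]
    by_cases hu : u = 0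
    · left; simp [hu]
    right
    obtain ⟨r, hr, hk⟩ := hcov _ (Nat.testBit_log2_self hu)
    refine ⟨r, hs hr, ?_⟩
    have hne : Nat.beq (Nat.land r (Nat.pow 2 (Nat.log2 u))) 0 = false := by
      rw [← Bool.not_eq_true, Nat.beq_eq]
      intro h
      change r &&& 2 ^ u.log2 = 0 at h
      have := congrArg (fun m => Nat.testBit m u.log2) h
      simp [hk] at this
    rw [hne]
    refine ih _ (s.erase r) (fun x hx => hs (List.mem_of_mem_erase hx)) ?_ ?_
    · rw [List.length_erase_of_mem hr, hlen]; rfl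
    · intro k hk'
      change (u ^^^ (u &&& r)).testBit k = true at hk'
      rw [Nat.testBit_xor, Nat.testBit_and] at hk'
      have h1 : u.testBit k = true := by
        cases h : u.testBit k <;> simp_all
      have h2 : r.testBit k = false := by
        cases h : r.testBit k <;> simp_all
      obtain ⟨r', hr', hk''⟩ := hcov k h1
      refine ⟨r', (List.mem_erase_of_ne ?_).2 hr', hk''⟩
      rintro rfl
      simp_all

/-- Seven subsets of a set with at most five elements cannot be arranged cyclically such that no
union of two neighbours contains a third one. -/
theorem exists_subset_union_of_card_le_five {T : Type*} [Finite T] (hT : Nat.card T ≤ 5)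
    (A : Fin 7 → Set T) : ∃ i j : Fin 7, i ≠ j ∧ i ≠ j + 1 ∧ A i ⊆ A j ∪ A (j + 1) := by
  classical
  by_contra! hA
  let e : T → Fin 5 := fun t => Fin.castLE hT (Finite.equivFin T t)
  have he : Function.Injective e := fun a b h => by simpa [e] using h
  -- The vertices carrying label `c`. If fewer than five labels exist, the missing ones give empty
  -- rectangles.
  let m : Fin 5 → ℕ := fun c => Nat.ofBits (n := 7) fun i => decide (∃ t ∈ A i, e t = c)
  have hm : ∀ c, m c < 128 := fun c => Nat.ofBits_lt_two_pow _
  choose r hr hmr using fun c => exists_slackRectangles_ge (m c) (hm c)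
  have hrect : ∀ c k, (slackRectangle (m c)).testBit k = true → (r c).testBit k = true := by
    intro c k hk
    have h := hmr c
    change slackRectangle (m c) &&& r c = _ at h
    rw [← h, Nat.testBit_and] at hk
    simp_all
  -- The argument `4` stands for five masks.
  have := coverable_of_cover (l := slackRectangles) 4 slackSupport (List.ofFn r) ?_ (by simp) ?_
  · rw [not_coverable_slackSupport] at this; exact Bool.noConfusion this
  · intro x hx
    obtain ⟨c, rfl⟩ := List.mem_ofFn.1 hx
    exact hr c
  · intro k hk
    rw [slackSupport, Nat.testBit_ofBits] at hk
    split_ifs at hk with hk49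
    simp only [Bool.and_eq_true, decide_eq_true_eq] at hk
    have hi : k / 7 < 7 := by omega
    have hj : k % 7 < 7 := by omega
    have hj1 : (⟨k % 7, hj⟩ + 1 : Fin 7).1 = (k % 7 + 1) % 7 := by simp [Fin.val_add]
    obtain ⟨t, ht, htn⟩ := Set.not_subset.1 (hA ⟨k / 7, hi⟩ ⟨k % 7, hj⟩
      (fun h => hk.1 (Fin.ext_iff.1 h)) (fun h => hk.2 ((Fin.ext_iff.1 h).trans hj1)))
    refine ⟨r (e t), List.mem_ofFn.2 ⟨_, rfl⟩, hrect _ _ ?_⟩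
    have hbit : ∀ i : Fin 7, (m (e t)).testBit i.1 = decide (t ∈ A i) := by
      intro i
      rw [Nat.testBit_ofBits_lt _ _ i.2]
      congr 1
      apply propext
      exact ⟨fun ⟨s, hs, h⟩ => he h ▸ hs, fun h => ⟨t, h, rfl⟩⟩
    rw [slackRectangle, Nat.testBit_ofBits_lt _ _ hk49]
    have h1 := hbit ⟨k / 7, hi⟩
    have h2 := hbit ⟨k % 7, hj⟩
    have h3 := hbit (⟨k % 7, hj⟩ + 1)
    rw [hj1] at h3
    simp only [Set.mem_union, not_or] at htn
    simp only at h1 h2 h3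
    simp only [h1, h2, h3]
    simp [ht, htn.1, htn.2]

/-! ### Orientations and convex heptagons. -/

/-- The signed area (twice) of the triangle `a b c` in the plane. -/
def orient (a b c : EuclideanSpace ℝ (Fin 2)) : ℝ :=
  (b 0 - a 0) * (c 1 - a 1) - (b 1 - a 1) * (c 0 - a 0)

/-- The points `p 0, …, p 6` are the vertices of a convex heptagon in counterclockwise order. -/
def IsConvexHeptagon (p : Fin 7 → EuclideanSpace ℝ (Fin 2)) : Prop :=
  ∀ i j k, i < j → j < k → 0 < orient (p i) (p j) (p k)

theorem orient_rotate (a b c : EuclideanSpace ℝ (Fin 2)) : orient b c a = orient a b c := by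
  simp only [orient]; ring

theorem orient_swap (a b c : EuclideanSpace ℝ (Fin 2)) : orient a c b = -orient a b c := by
  simp only [orient]; ring

theorem orient_self_left (a b : EuclideanSpace ℝ (Fin 2)) : orient a a b = 0 := by
  simp only [orient]; ring

theorem orient_self_right (a b : EuclideanSpace ℝ (Fin 2)) : orient a b b = 0 := by
  simp only [orient]; ring

theorem orient_self_outer (a b : EuclideanSpace ℝ (Fin 2)) : orient a b a = 0 := by
  simp only [orient]; ring

/-- The three-term Grassmann–Plücker relation. -/
theorem orient_mul_orient (a b c d e : EuclideanSpace ℝ (Fin 2)) :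
    orient a b d * orient a c e = orient a b c * orient a d e + orient a b e * orient a c d := by
  simp only [orient]; ring

theorem orient_combination (a b : EuclideanSpace ℝ (Fin 2)) {s t : ℝ} (h : s + t = 1)
    (x y : EuclideanSpace ℝ (Fin 2)) :
    orient a b (s • x + t • y) = s * orient a b x + t * orient a b y := by
  obtain rfl : s = 1 - t := by linarith
  simp only [orient, PiLp.add_apply, PiLp.smul_apply, smul_eq_mul]; ring

theorem convex_orient_nonneg (a b : EuclideanSpace ℝ (Fin 2)) :
    Convex ℝ {x | 0 ≤ orient a b x} := by
  intro x hx y hy s t hs ht hst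
  simp only [Set.mem_ofPred_eq] at *
  rw [orient_combination a b hst]
  positivity

/-- The three signed areas, divided by the area of the triangle, are the barycentric coordinates of
`x`. -/
theorem Convex.mem_of_orient_nonneg {s : Set (EuclideanSpace ℝ (Fin 2))} (hs : Convex ℝ s)
    {a b c x : EuclideanSpace ℝ (Fin 2)} (has : a ∈ s) (hbs : b ∈ s) (hcs : c ∈ s)
    (h : 0 < orient a b c) (ha : 0 ≤ orient b c x) (hb : 0 ≤ orient c a x)
    (hc : 0 ≤ orient a b x) : x ∈ s := by
  have hsum : orient b c x + orient c a x + orient a b x = orient a b c := by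
    simp only [orient]; ring
  have hx : (orient b c x / orient a b c) • a + (orient c a x / orient a b c) • b +
      (orient a b x / orient a b c) • c = x := by
    ext i
    simp only [PiLp.add_apply, PiLp.smul_apply, smul_eq_mul]
    field_simp
    fin_cases i <;> simp only [orient, Fin.zero_eta, Fin.mk_one] <;> ring
  have := hs.sum_mem (t := Finset.univ) (z := ![a, b, c])
    (w := ![orient b c x / orient a b c, orient c a x / orient a b c, orient a b x / orient a b c])
    (by intro i _; fin_cases i <;> simp <;> positivity)
    (by simp only [Fin.sum_univ_three, Matrix.cons_val]
        rw [← add_div, ← add_div, hsum, div_self h.ne'])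
    (by intro i _; fin_cases i <;> simpa)
  simpa only [Fin.sum_univ_three, Matrix.cons_val, hx] using this

theorem IsConvexHeptagon.orient_pos {p : Fin 7 → EuclideanSpace ℝ (Fin 2)}
    (hp : IsConvexHeptagon p) {a b c : Fin 7}
    (h : a < b ∧ b < c ∨ b < c ∧ c < a ∨ c < a ∧ a < b) : 0 < orient (p a) (p b) (p c) := by
  rcases h with h | h | h
  · exact hp _ _ _ h.1 h.2
  · rw [← orient_rotate]; exact hp _ _ _ h.1 h.2
  · rw [← orient_rotate, ← orient_rotate]; exact hp _ _ _ h.1 h.2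

theorem IsConvexHeptagon.rotate {p : Fin 7 → EuclideanSpace ℝ (Fin 2)}
    (hp : IsConvexHeptagon p) (r : Fin 7) : IsConvexHeptagon fun i => p (r + i) := by
  intro i j k hij hjk
  apply hp.orient_pos
  revert r i j k
  decide +kernel

theorem IsConvexHeptagon.orient_edge_pos {p : Fin 7 → EuclideanSpace ℝ (Fin 2)}
    (hp : IsConvexHeptagon p) {i k : Fin 7} (h : i ≠ k) (h' : i ≠ k + 1) :
    0 < orient (p k) (p (k + 1)) (p i) := by
  apply hp.orient_pos
  revert i k
  decide +kernel

theorem IsConvexHeptagon.orient_edge_nonneg {p : Fin 7 → EuclideanSpace ℝ (Fin 2)}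
    (hp : IsConvexHeptagon p) (i k : Fin 7) : 0 ≤ orient (p k) (p (k + 1)) (p i) := by
  by_cases h : i = k
  · rw [h, orient_self_outer]
  by_cases h' : i = k + 1
  · rw [h', orient_self_right]
  exact (hp.orient_edge_pos h h').le

/-- For the reverse inclusion, triangulate by a fan at `p 0`: `orient (p 0) (p k) x` is nonnegative
at `k = 1` and nonpositive at `k = 6`, and where the sign changes `x` lies in the triangle `p 0`, `p
k`, `p (k + 1)`. -/
theorem IsConvexHeptagon.convexHull_eq {p : Fin 7 → EuclideanSpace ℝ (Fin 2)}
    (hp : IsConvexHeptagon p) :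
    convexHull ℝ (Set.range p) = {x | ∀ k, 0 ≤ orient (p k) (p (k + 1)) x} := by
  apply Set.Subset.antisymm
  · intro x hx k
    refine convexHull_min ?_ (convex_orient_nonneg (p k) (p (k + 1))) hx
    rintro _ ⟨i, rfl⟩
    exact hp.orient_edge_nonneg i k
  · intro x hx
    have hx' : ∀ k, 0 ≤ orient (p k) (p (k + 1)) x := hx
    have fan : ∀ k : Fin 7, 0 < k → k < k + 1 → 0 ≤ orient (p 0) (p k) x →
        orient (p 0) (p (k + 1)) x ≤ 0 → x ∈ convexHull ℝ (Set.range p) := by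
      intro k h0 hk h1 h2
      have hm : ∀ i, p i ∈ convexHull ℝ (Set.range p) :=
        fun i => subset_convexHull ℝ _ ⟨i, rfl⟩
      refine (convex_convexHull ℝ _).mem_of_orient_nonneg (hm 0) (hm k) (hm (k + 1))
        (hp 0 k (k + 1) h0 hk) (hx' k) ?_ h1
      rw [← orient_rotate, orient_swap]
      linarith
    have h6 : orient (p 0) (p 6) x ≤ 0 := by
      have h := hx' 6
      rw [show (6 + 1 : Fin 7) = 0 from rfl, ← orient_rotate, orient_swap] at h
      linarith
    rcases le_total (orient (p 0) (p 2) x) 0 with h2 | h2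
    · exact fan 1 (by decide) (by decide) (hx' 0) h2
    rcases le_total (orient (p 0) (p 3) x) 0 with h3 | h3
    · exact fan 2 (by decide) (by decide) h2 h3
    rcases le_total (orient (p 0) (p 4) x) 0 with h4 | h4
    · exact fan 3 (by decide) (by decide) h3 h4
    rcases le_total (orient (p 0) (p 5) x) 0 with h5 | h5
    · exact fan 4 (by decide) (by decide) h4 h5
    · exact fan 5 (by decide) (by decide) h5 h6

/-! ### Vertices of a polygon in counterclockwise order. -/

theorem IsPolytope.convex {d : ℕ} {Q : Set (EuclideanSpace ℝ (Fin d))} (hQ : IsPolytope Q) :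
    Convex ℝ Q := by
  obtain ⟨s, -, rfl⟩ := hQ
  exact convex_convexHull ℝ s

theorem IsPolytope.finite_vertexSet {d : ℕ} {Q : Set (EuclideanSpace ℝ (Fin d))}
    (hQ : IsPolytope Q) : (vertexSet Q).Finite := by
  obtain ⟨s, hs, rfl⟩ := hQ
  exact hs.subset extremePoints_convexHull_subset

theorem IsCompact.eq_convexHull_vertexSet {d : ℕ} {Q : Set (EuclideanSpace ℝ (Fin d))}
    (hQ : IsCompact Q) (hc : Convex ℝ Q) (hf : (vertexSet Q).Finite) :
    Q = convexHull ℝ (vertexSet Q) := by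
  conv_lhs => rw [← closure_convexHull_extremePoints hQ hc]
  exact (hf.isClosed_convexHull (𝕜 := ℝ)).closure_eq

theorem IsPolytope.eq_convexHull_vertexSet {d : ℕ} {Q : Set (EuclideanSpace ℝ (Fin d))}
    (hQ : IsPolytope Q) : Q = convexHull ℝ (vertexSet Q) := by
  refine IsCompact.eq_convexHull_vertexSet ?_ hQ.convex hQ.finite_vertexSet
  obtain ⟨s, hs, rfl⟩ := hQ
  exact hs.isCompact_convexHull (𝕜 := ℝ)

theorem notMem_of_mem_extremePoints {E : Type*} [AddCommGroup E] [Module ℝ E] {P s : Set E}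
    (hP : Convex ℝ P) {x : E} (hx : x ∈ P.extremePoints ℝ) (hs : s ⊆ P) (hxs : x ∉ s) :
    x ∉ convexHull ℝ s := by
  have h := (hP.mem_extremePoints_iff_mem_sdiff_convexHull_sdiff.1 hx).2
  have hsub : s ⊆ P \ {x} := fun y hy => ⟨hs hy, fun h => hxs (h ▸ hy)⟩
  exact fun hxc => h (convexHull_mono hsub hxc)

theorem exists_smul_eq_of_orient_eq_zero {a b c : EuclideanSpace ℝ (Fin 2)}
    (h : orient a b c = 0) (hb : b ≠ a) : ∃ t : ℝ, c = a + t • (b - a) := by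
  by_cases h0 : b 0 = a 0
  · have h1 : b 1 - a 1 ≠ 0 := fun h1 => hb (by
      ext i; fin_cases i
      · exact h0
      · exact sub_eq_zero.1 h1)
    refine ⟨(c 1 - a 1) / (b 1 - a 1), ?_⟩
    have h2 : c 0 - a 0 = 0 := by
      simp only [orient, h0] at h
      have : (b 1 - a 1) * (c 0 - a 0) = 0 := by linarith
      exact (mul_eq_zero.1 this).resolve_left h1
    ext i; fin_cases i
    · simp [h0]; linarith
    · simp; field_simp; ring
  · have h1 : b 0 - a 0 ≠ 0 := sub_ne_zero.2 h0
    refine ⟨(c 0 - a 0) / (b 0 - a 0), ?_⟩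
    ext i; fin_cases i
    · simp; field_simp; ring
    · simp only [orient] at h
      simp; field_simp; linarith

theorem Set.mem_convexHull_pair_of_smul {a b : EuclideanSpace ℝ (Fin 2)} {t : ℝ} (h0 : 0 ≤ t)
    (h1 : t ≤ 1) : a + t • (b - a) ∈ convexHull ℝ {a, b} := by
  rw [convexHull_pair]
  exact ⟨1 - t, t, by linarith, h0, by ring, by module⟩

/-- Of three collinear points one lies between the others and is not extreme; the position of `t`
relative to `0` and `1` tells which. -/
theorem orient_ne_zero_of_extremePoints {P : Set (EuclideanSpace ℝ (Fin 2))} (hP : Convex ℝ P)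
    {a b c : EuclideanSpace ℝ (Fin 2)} (ha : a ∈ P.extremePoints ℝ) (hb : b ∈ P.extremePoints ℝ)
    (hc : c ∈ P.extremePoints ℝ) (hab : a ≠ b) (hac : a ≠ c) (hbc : b ≠ c) :
    orient a b c ≠ 0 := by
  intro h
  obtain ⟨t, ht⟩ := exists_smul_eq_of_orient_eq_zero h hab.symm
  have sub : ∀ {x y}, x ∈ P.extremePoints ℝ → y ∈ P.extremePoints ℝ → ({x, y} : Set _) ⊆ P := by
    rintro x y hx hy z (rfl | rfl)
    exacts [hx.1, hy.1]
  rcases le_or_gt t 0 with h0 | h0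
  · refine notMem_of_mem_extremePoints hP ha (sub hb hc) (by simp [hab, hac]) ?_
    rw [convexHull_pair]
    have : 0 < 1 - t := by linarith
    refine ⟨-t / (1 - t), 1 / (1 - t), by apply div_nonneg <;> linarith, by positivity,
      by field_simp; ring, ?_⟩
    rw [ht]
    ext i
    simp; field_simp; ring
  rcases le_or_gt t 1 with h1 | h1
  · refine notMem_of_mem_extremePoints hP hc (sub ha hb) (by simp [hac.symm, hbc.symm]) ?_
    rw [ht]
    exact Set.mem_convexHull_pair_of_smul h0.le h1
  · refine notMem_of_mem_extremePoints hP hb (sub ha hc) (by simp [hab.symm, hbc]) ?_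
    have : b = a + t⁻¹ • (c - a) := by
      rw [ht, add_sub_cancel_left, smul_smul, inv_mul_cancel₀ h0.ne']
      simp
    rw [this]
    exact Set.mem_convexHull_pair_of_smul (by positivity) (inv_le_one_of_one_le₀ h1.le)

/-- The slope of the line from `a` to `b`, with `⊥` for `b = a` and `⊤` for vertical lines. -/
noncomputable def slopeFrom (a b : EuclideanSpace ℝ (Fin 2)) : EReal :=
  open scoped Classical in
  if b = a then ⊥ else if b 0 = a 0 then ⊤ else (((b 1 - a 1) / (b 0 - a 0) : ℝ) : EReal)

theorem slopeFrom_eq_bot {a b : EuclideanSpace ℝ (Fin 2)} : slopeFrom a b = ⊥ ↔ b = a := by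
  unfold slopeFrom
  split_ifs <;> simp_all

/-- Seen from the lexicographically least point, all others lie in a half-plane where the order by
slope is the angular order. -/
theorem orient_nonneg_of_slopeFrom_le {a b c : EuclideanSpace ℝ (Fin 2)}
    (hb : b = a ∨ a 0 < b 0 ∨ a 0 = b 0 ∧ a 1 < b 1)
    (hc : c = a ∨ a 0 < c 0 ∨ a 0 = c 0 ∧ a 1 < c 1) (hca : c ≠ a)
    (h : slopeFrom a b ≤ slopeFrom a c) : 0 ≤ orient a b c := by
  by_cases hba : b = a
  · rw [hba, orient_self_left]
  simp only [hba, hca, false_or] at hb hc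
  unfold slopeFrom at h
  rw [if_neg hba, if_neg hca] at h
  unfold orient
  rcases hc with hc | ⟨hc, hc'⟩
  · rw [if_neg hc.ne'] at h
    rcases hb with hb | ⟨hb, hb'⟩
    · rw [if_neg hb.ne', EReal.coe_le_coe_iff, div_le_div_iff₀ (by linarith) (by linarith)] at h
      linarith
    · rw [if_pos hb.symm] at h
      simp at h
  · rw [← hc]
    have : a 0 ≤ b 0 := by rcases hb with hb | hb <;> linarith
    nlinarith

/-- Sort the vertices by slope around the lexicographically least one, which comes first with slope
`⊥`. Triples through `p 0` are then positively oriented. If `p i, p j, p k` were not, `p j` would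
lie in the triangle `p 0, p i, p k`, contradicting extremality. -/
theorem exists_isConvexHeptagon {P : Set (EuclideanSpace ℝ (Fin 2))} (hP : IsNGon 7 P) :
    ∃ p : Fin 7 → EuclideanSpace ℝ (Fin 2), IsConvexHeptagon p ∧
      P = convexHull ℝ (Set.range p) := by
  obtain ⟨hpoly, -, hcard⟩ := hP
  have hconv := hpoly.convex
  have hfin := hpoly.finite_vertexSet
  have hncard : Nat.card (vertexSet P) = 7 := by
    rw [Nat.card_coe_set_eq, Set.ncard, hcard]; rfl
  have := hfin.to_subtype
  let v : Fin 7 ≃ vertexSet P := (Finite.equivFinOfCardEq hncard).symm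
  obtain ⟨i₀, hi₀⟩ := Finite.exists_min (fun i => toLex ((v i).1 0, (v i).1 1))
  have hlex : ∀ i, (v i).1 = (v i₀).1 ∨ (v i₀).1 0 < (v i).1 0 ∨
      (v i₀).1 0 = (v i).1 0 ∧ (v i₀).1 1 < (v i).1 1 := by
    intro i
    have h := hi₀ i
    rw [Prod.Lex.le_iff] at h
    simp only [ofLex_toLex] at h
    rcases h with h | ⟨h, h'⟩
    · exact Or.inr (Or.inl h)
    · rcases h'.lt_or_eq with h' | h'
      · exact Or.inr (Or.inr ⟨h, h'⟩)
      · left; ext j; fin_cases j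
        exacts [h.symm, h'.symm]
  let key : Fin 7 → EReal := fun i => slopeFrom (v i₀).1 (v i).1
  let σ := Tuple.sort key
  have hσ : Monotone (key ∘ σ) := Tuple.monotone_sort key
  let p : Fin 7 → EuclideanSpace ℝ (Fin 2) := fun i => (v (σ i)).1
  have hpinj : Function.Injective p :=
    Subtype.val_injective.comp (v.injective.comp σ.injective)
  have hext : ∀ i, p i ∈ P.extremePoints ℝ := fun i => (v (σ i)).2
  have hrange : Set.range p = vertexSet P := by
    ext x
    constructor
    · rintro ⟨i, rfl⟩; exact hext i
    · intro hx
      exact ⟨σ.symm (v.symm ⟨x, hx⟩), by simp [p]⟩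
  have hp0 : p 0 = (v i₀).1 := by
    have h : key (σ 0) ≤ key (σ (σ.symm i₀)) := hσ (Fin.zero_le _)
    rw [Equiv.apply_symm_apply, show key i₀ = ⊥ from slopeFrom_eq_bot.2 rfl, le_bot_iff] at h
    exact slopeFrom_eq_bot.1 h
  have hpos0 : ∀ i j, 0 < i → i < j → 0 < orient (p 0) (p i) (p j) := by
    intro i j hi hij
    refine lt_of_le_of_ne ?_ (orient_ne_zero_of_extremePoints hconv (hext 0) (hext i) (hext j)
      (hpinj.ne hi.ne) (hpinj.ne (hi.trans hij).ne) (hpinj.ne hij.ne)).symm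
    have hne : p j ≠ p 0 := hpinj.ne (hi.trans hij).ne'
    rw [hp0] at hne ⊢
    exact orient_nonneg_of_slopeFrom_le (hlex _) (hlex _) hne (hσ hij.le)
  refine ⟨p, fun i j k hij hjk => ?_, by rw [hrange]; exact hpoly.eq_convexHull_vertexSet⟩
  rcases (Fin.zero_le i).eq_or_lt with rfl | hi
  · exact hpos0 _ _ hij hjk
  by_contra! hle
  refine notMem_of_mem_extremePoints (s := {p 0, p i, p k}) hconv (hext j) ?_ ?_ ?_
  · rintro x (rfl | rfl | rfl)
    exacts [(hext 0).1, (hext i).1, (hext k).1]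
  · simp only [Set.mem_insert_iff, Set.mem_singleton_iff, hpinj.eq_iff, not_or]
    exact ⟨(hi.trans hij).ne', hij.ne', hjk.ne⟩
  · refine (convex_convexHull ℝ _).mem_of_orient_nonneg (a := p 0) (b := p i) (c := p k)
      (subset_convexHull ℝ _ (by simp)) (subset_convexHull ℝ _ (by simp))
      (subset_convexHull ℝ _ (by simp)) (hpos0 i k hi (hij.trans hjk)) ?_ ?_
      (hpos0 i j hi hij).le
    · rw [orient_swap]; linarith
    · rw [← orient_rotate]; exact (hpos0 j k (hi.trans hij) hjk).le

/-! ### Farkas' lemma and facets through a point. -/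

/-- **Farkas' lemma** for finitely many linear functionals on a real vector space. -/
theorem exists_nonneg_combination_of_forall_nonpos {V : Type*} [AddCommGroup V] [Module ℝ V]
    {n : ℕ} (a : Fin n → V →ₗ[ℝ] ℝ) (b : V →ₗ[ℝ] ℝ)
    (h : ∀ x, (∀ i, a i x ≤ 0) → b x ≤ 0) :
    ∃ c : Fin n → ℝ, (∀ i, 0 ≤ c i) ∧ b = ∑ i, c i • a i := by
  induction n generalizing b with
  | zero =>
    refine ⟨fun _ => 0, fun _ => le_rfl, ?_⟩
    ext x
    have h1 := h x (fun i => i.elim0)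
    have h2 := h (-x) (fun i => i.elim0)
    rw [map_neg] at h2
    simp only [Finset.univ_eq_empty, Finset.sum_empty, LinearMap.zero_apply]
    linarith
  | succ n ih =>
    -- Either the last functional is redundant and gets coefficient `0`, or some `z` violates the
    -- implication without it.
    by_cases h' : ∀ x, (∀ i : Fin n, a i.castSucc x ≤ 0) → b x ≤ 0
    · obtain ⟨c, hc, hb⟩ := ih (fun i => a i.castSucc) b h'
      refine ⟨Fin.snoc c 0, fun i => ?_, ?_⟩
      · refine Fin.lastCases ?_ (fun i => ?_) i <;> simp [hc]
      · simpa [Fin.sum_univ_castSucc] using hb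
    push Not at h'
    obtain ⟨z₀, hz₀, hbz₀⟩ := h'
    have hlast : 0 < a (Fin.last n) z₀ := by
      by_contra! hle
      exact absurd (h z₀ (fun i => Fin.lastCases hle hz₀ i)) (not_le.2 hbz₀)
    obtain ⟨z, hz, hbz, haz⟩ : ∃ z, (∀ i : Fin n, a i.castSucc z ≤ 0) ∧ 0 < b z ∧
        a (Fin.last n) z = 1 := by
      refine ⟨(a (Fin.last n) z₀)⁻¹ • z₀, fun i => ?_, ?_, ?_⟩
      · rw [map_smul, smul_eq_mul]
        exact mul_nonpos_of_nonneg_of_nonpos (by positivity) (hz₀ i)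
      · rw [map_smul, smul_eq_mul]; positivity
      · rw [map_smul, smul_eq_mul, inv_mul_cancel₀ hlast.ne']
    -- Apply the induction hypothesis after projecting along `z` onto the kernel of the last
    -- functional. Undoing the projection gives that functional the coefficient `b z - ∑ i, c i * a
    -- i.castSucc z`, nonnegative by the choice of `z`.
    obtain ⟨c, hc, hb⟩ := ih (fun i => a i.castSucc - a i.castSucc z • a (Fin.last n))
      (b - b z • a (Fin.last n)) (by
        intro x hx
        have := h (x - a (Fin.last n) x • z) (fun i => by
          refine Fin.lastCases ?_ (fun i => ?_) i
          · simp [haz]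
          · have := hx i
            simp only [LinearMap.sub_apply, LinearMap.smul_apply, smul_eq_mul] at this
            simp only [map_sub, map_smul, smul_eq_mul]
            linarith)
        simp only [map_sub, map_smul, smul_eq_mul] at this
        simp only [LinearMap.sub_apply, LinearMap.smul_apply, smul_eq_mul]
        linarith)
    refine ⟨Fin.snoc c (b z - ∑ i, c i * a i.castSucc z), fun i => ?_, ?_⟩
    · refine Fin.lastCases ?_ (fun i => ?_) i
      · have : ∑ i, c i * a i.castSucc z ≤ 0 :=
          Finset.sum_nonpos fun i _ => mul_nonpos_of_nonneg_of_nonpos (hc i) (hz i)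
        simp only [Fin.snoc_last]
        linarith
      · simpa using hc i
    · ext x
      have := congrArg (fun g : V →ₗ[ℝ] ℝ => g x) hb
      simp only [LinearMap.sub_apply, LinearMap.smul_apply, smul_eq_mul, LinearMap.sum_apply,
        mul_sub, Finset.sum_sub_distrib, ← mul_assoc, ← Finset.sum_mul] at this
      simp only [Fin.sum_univ_castSucc, Fin.snoc_castSucc, Fin.snoc_last, LinearMap.add_apply,
        LinearMap.sum_apply, LinearMap.smul_apply, smul_eq_mul]
      linarith

section Facets

variable {d : ℕ} {Q : Set (EuclideanSpace ℝ (Fin d))} {x y : EuclideanSpace ℝ (Fin d)}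

theorem IsPolytope.exists_range (hQ : IsPolytope Q) :
    ∃ (n : ℕ) (g : Fin n → EuclideanSpace ℝ (Fin d)), Q = convexHull ℝ (Set.range g) := by
  obtain ⟨s, hs, rfl⟩ := hQ
  obtain ⟨n, g, -, rfl⟩ := hs.fin_param
  exact ⟨n, g, rfl⟩

/-- If a polytope cannot be left slightly at `x` in the direction away from `y`, then it has a
supporting hyperplane through `x` that avoids `y`. -/
theorem exists_supporting_functional {n : ℕ} {g : Fin n → EuclideanSpace ℝ (Fin d)}
    (hx : x ∈ convexHull ℝ (Set.range g))
    (h : ∀ ε : ℝ, 0 < ε → AffineMap.lineMap y x (1 + ε) ∉ convexHull ℝ (Set.range g)) :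
    ∃ l : EuclideanSpace ℝ (Fin d) →ₗ[ℝ] ℝ, (∀ i, l (g i) ≤ l x) ∧ l y < l x := by
  by_contra! hno
  -- Without a separating functional, Farkas puts `x - y` in the cone of the `g i - x`. Moving from
  -- `x` by `x - y` divided by the total coefficient is then a convex combination of the `g i`;
  -- total coefficient zero means `x = y`.
  obtain ⟨c, hc, hsum⟩ := exists_nonneg_combination_of_forall_nonpos
    (fun i => (innerₗ (EuclideanSpace ℝ (Fin d)) (g i - x))) (innerₗ _ (x - y)) (by
      intro w hw
      have := hno (innerₗ _ w) (fun i => by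
        have := hw i
        rw [innerₗ_apply_apply, real_inner_comm, inner_sub_right] at this
        simp only [innerₗ_apply_apply]
        linarith)
      rw [innerₗ_apply_apply, real_inner_comm, inner_sub_right]
      simp only [innerₗ_apply_apply] at this
      linarith)
  have hxy : x - y = ∑ i, c i • (g i - x) := by
    refine ext_inner_right ℝ fun w => ?_
    have := congrArg (fun f : EuclideanSpace ℝ (Fin d) →ₗ[ℝ] ℝ => f w) hsum
    simpa [sum_inner, real_inner_smul_left, inner_sub_left, inner_smul_left] using this
  rcases (Finset.sum_nonneg fun i _ => hc i : 0 ≤ ∑ i, c i).eq_or_lt with h0 | h0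
  · have hc0 : ∀ i, c i = 0 := fun i =>
      (Finset.sum_eq_zero_iff_of_nonneg fun i _ => hc i).1 h0.symm i (Finset.mem_univ i)
    simp only [hc0, zero_smul, Finset.sum_const_zero, sub_eq_zero] at hxy
    apply h 1 one_pos
    rw [← hxy]
    simpa using hx
  · set C := ∑ i, c i with hC
    apply h C⁻¹ (by positivity)
    have : AffineMap.lineMap y x (1 + C⁻¹) = ∑ i, (C⁻¹ * c i) • g i := by
      have h1 : AffineMap.lineMap y x (1 + C⁻¹) = x + C⁻¹ • (x - y) := by
        rw [AffineMap.lineMap_apply_module]; module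
      rw [h1, hxy]
      simp only [smul_sub, Finset.sum_sub_distrib, ← Finset.sum_smul, ← hC, Finset.smul_sum,
        smul_smul, inv_mul_cancel₀ h0.ne', one_smul]
      abel
    rw [this]
    refine (convex_convexHull ℝ _).sum_mem (fun i _ => mul_nonneg (by positivity) (hc i)) ?_
      (fun i _ => subset_convexHull ℝ _ ⟨i, rfl⟩)
    rw [← Finset.mul_sum, ← hC, inv_mul_cancel₀ h0.ne']

theorem map_le_of_mem_convexHull {n : ℕ} {g : Fin n → EuclideanSpace ℝ (Fin d)}
    {l : EuclideanSpace ℝ (Fin d) →ₗ[ℝ] ℝ} {r : ℝ} (h : ∀ i, l (g i) ≤ r)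
    {z : EuclideanSpace ℝ (Fin d)} (hz : z ∈ convexHull ℝ (Set.range g)) : l z ≤ r := by
  refine convexHull_min ?_ (convex_halfSpace_le l.isLinear r) hz
  rintro _ ⟨i, rfl⟩
  exact h i

theorem vectorSpan_le_iff_of_mem {s : Set (EuclideanSpace ℝ (Fin d))} (hx : x ∈ s)
    (G : Submodule ℝ (EuclideanSpace ℝ (Fin d))) :
    vectorSpan ℝ s ≤ G ↔ ∀ z ∈ s, z - x ∈ G := by
  rw [vectorSpan_eq_span_vsub_set_right ℝ hx, Submodule.span_le]
  simp [Set.subset_def]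

/-- Tilt the supporting hyperplane about the face `F` and the direction `y - x`. As `F` is not a
facet, these span too little to contain all directions of `Q`, so the hyperplane can be turned until
it meets a new generator. Fixing the direction `y - x` preserves the gap between `y` and `x`. -/
theorem exists_functional_larger_face {n : ℕ} {g : Fin n → EuclideanSpace ℝ (Fin d)}
    (hQ : Q = convexHull ℝ (Set.range g)) (hx : x ∈ Q) (hy : y ∈ Q)
    {l : EuclideanSpace ℝ (Fin d) →ₗ[ℝ] ℝ} (hl : ∀ i, l (g i) ≤ l x) (hly : l y < l x)
    (hdim : polyDim {z ∈ Q | l z = l x} + 1 ≠ polyDim Q) :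
    ∃ l' : EuclideanSpace ℝ (Fin d) →ₗ[ℝ] ℝ, (∀ i, l' (g i) ≤ l' x) ∧ l' y < l' x ∧
      polyDim {z ∈ Q | l z = l x} < polyDim {z ∈ Q | l' z = l' x} := by
  set F := {z ∈ Q | l z = l x} with hF
  have hxF : x ∈ F := ⟨hx, rfl⟩
  have hker : vectorSpan ℝ F ≤ LinearMap.ker l := by
    rw [vectorSpan_le_iff_of_mem hxF]
    intro z hz
    rw [LinearMap.mem_ker, map_sub, hz.2, sub_self]
  have hlt : vectorSpan ℝ F < vectorSpan ℝ Q := by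
    refine lt_of_le_of_ne (vectorSpan_mono ℝ fun z hz => hz.1) fun heq => ?_
    have : y - x ∈ vectorSpan ℝ F := by
      rw [heq]; exact vsub_mem_vectorSpan ℝ hy hx
    have := hker this
    rw [LinearMap.mem_ker, map_sub] at this
    linarith
  have hlt' := Submodule.finrank_lt_finrank_of_lt hlt
  set G := vectorSpan ℝ F ⊔ Submodule.span ℝ {y - x} with hG
  have hGrank : Module.finrank ℝ G ≤ Module.finrank ℝ (vectorSpan ℝ F) + 1 :=
    (Submodule.finrank_add_le_finrank_add_finrank _ _).trans
      (Nat.add_le_add_left ((finrank_span_le_card _).trans (by simp)) _)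
  obtain ⟨i₀, hi₀⟩ : ∃ i, g i - x ∉ G := by
    by_contra! hall
    have hle : vectorSpan ℝ Q ≤ G := by
      rw [vectorSpan_le_iff_of_mem hx]
      intro z hz
      rw [hQ] at hz
      have hconv : Convex ℝ {z | z - x ∈ G} := by
        intro a ha b hb s t _ _ hst
        have : s • a + t • b - x = s • (a - x) + t • (b - x) := by
          rw [smul_sub, smul_sub]
          nth_rewrite 1 [← one_smul ℝ x]
          rw [← hst]; module
        change s • a + t • b - x ∈ G
        rw [this]
        exact G.add_mem (G.smul_mem _ ha) (G.smul_mem _ hb)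
      refine convexHull_min ?_ hconv hz
      rintro _ ⟨i, rfl⟩
      exact hall i
    have := Submodule.finrank_mono hle
    unfold polyDim at hdim
    omega
  obtain ⟨m, hm₀, hGm⟩ : ∃ m : EuclideanSpace ℝ (Fin d) →ₗ[ℝ] ℝ, 0 < m (g i₀ - x) ∧
      G ≤ LinearMap.ker m := by
    obtain ⟨f, hf, hGf⟩ := Submodule.exists_le_ker_of_notMem hi₀
    rcases hf.lt_or_gt with hf | hf
    · refine ⟨-f, by simpa using hf, fun z hz => ?_⟩
      have := hGf hz
      rw [LinearMap.mem_ker] at this ⊢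
      simp [this]
    · exact ⟨f, hf, hGf⟩
  -- Ratio test: the least `t` at which `l + t • m` takes its value at `x` at a generator with `m (g
  -- i - x) > 0`, so no generator overshoots.
  obtain ⟨i₁, hi₁, hmin⟩ := Finset.exists_min_image (Finset.univ.filter fun i => 0 < m (g i - x))
    (fun i => (l x - l (g i)) / m (g i - x)) ⟨i₀, by simpa using hm₀⟩
  simp only [Finset.mem_filter, Finset.mem_univ, true_and] at hi₁ hmin
  set t := (l x - l (g i₁)) / m (g i₁ - x) with ht
  have ht0 : 0 ≤ t := div_nonneg (by linarith [hl i₁]) hi₁.le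
  have hle : ∀ i, (l + t • m) (g i) ≤ (l + t • m) x := by
    intro i
    have h1 : t * m (g i - x) ≤ l x - l (g i) := by
      rcases lt_or_ge 0 (m (g i - x)) with h | h
      · rw [← le_div_iff₀ h]; exact hmin i h
      · have := mul_nonpos_of_nonneg_of_nonpos ht0 h
        linarith [hl i]
    rw [map_sub] at h1
    simp only [LinearMap.add_apply, LinearMap.smul_apply, smul_eq_mul]
    linarith
  have heq : ∀ z, z - x ∈ G → m z = m x := fun z hz => by
    have := hGm hz
    rw [LinearMap.mem_ker, map_sub] at this
    linarith
  have hGF : vectorSpan ℝ F ≤ G := le_sup_left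
  have hyG : y - x ∈ G := Submodule.mem_sup_right (Submodule.mem_span_singleton_self _)
  refine ⟨l + t • m, hle, ?_, ?_⟩
  · simp only [LinearMap.add_apply, LinearMap.smul_apply, smul_eq_mul, heq y hyG]
    linarith
  · refine Submodule.finrank_lt_finrank_of_lt (lt_of_le_of_ne (vectorSpan_mono ℝ ?_) ?_)
    · intro z hz
      refine ⟨hz.1, ?_⟩
      simp only [LinearMap.add_apply, LinearMap.smul_apply, smul_eq_mul, hz.2,
        heq z (hGF (vsub_mem_vectorSpan ℝ hz hxF))]
    · intro h
      have hmem : g i₁ - x ∈ vectorSpan ℝ F := by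
        rw [h]
        refine vsub_mem_vectorSpan ℝ (p₁ := g i₁) (p₂ := x) ⟨?_, ?_⟩ ⟨hx, rfl⟩
        · rw [hQ]; exact subset_convexHull ℝ _ ⟨i₁, rfl⟩
        · have : t * m (g i₁ - x) = l x - l (g i₁) := div_mul_cancel₀ _ hi₁.ne'
          rw [map_sub] at this
          simp only [LinearMap.add_apply, LinearMap.smul_apply, smul_eq_mul]
          linarith
      have := hGm (hGF hmem)
      rw [LinearMap.mem_ker] at this
      linarith

/-- If all facets through `x` contain `y`, the segment from `y` to `x` can be prolonged inside the
polytope. -/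
theorem IsPolytope.exists_lineMap_mem (hQ : IsPolytope Q) (hx : x ∈ Q) (hy : y ∈ Q)
    (hF : ∀ F ∈ facetSet Q, x ∈ F → y ∈ F) :
    ∃ ε : ℝ, 0 < ε ∧ AffineMap.lineMap y x (1 + ε) ∈ Q := by
  obtain ⟨n, g, hg⟩ := hQ.exists_range
  by_contra! h
  let S : Set (EuclideanSpace ℝ (Fin d) →ₗ[ℝ] ℝ) := {l | (∀ i, l (g i) ≤ l x) ∧ l y < l x}
  let dim : (EuclideanSpace ℝ (Fin d) →ₗ[ℝ] ℝ) → ℕ := fun l => polyDim {z ∈ Q | l z = l x}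
  obtain ⟨l₀, hl₀⟩ := exists_supporting_functional (hg ▸ hx) (hg ▸ h)
  have hbdd : BddAbove (dim '' S) := by
    refine ⟨Module.finrank ℝ (EuclideanSpace ℝ (Fin d)), ?_⟩
    rintro _ ⟨l, -, rfl⟩
    exact Submodule.finrank_le _
  -- A supporting face through `x` avoiding `y` of maximal dimension must be a facet, since
  -- otherwise it could be enlarged.
  obtain ⟨l, ⟨hl, hly⟩, hmax⟩ := Nat.sSup_mem (⟨_, l₀, hl₀, rfl⟩ : (dim '' S).Nonempty) hbdd
  have hdim : polyDim {z ∈ Q | l z = l x} + 1 = polyDim Q := by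
    by_contra hne
    obtain ⟨l', hl', hly', hlt⟩ := exists_functional_larger_face hg hx hy hl hly hne
    have := le_csSup hbdd ⟨l', ⟨hl', hly'⟩, rfl⟩
    rw [← hmax] at this
    exact absurd hlt (not_lt.2 this)
  have hlQ : ∀ z ∈ Q, l z ≤ l x := fun z hz => map_le_of_mem_convexHull hl (hg ▸ hz)
  have := hF {z ∈ Q | l z = l x} ⟨⟨x, hx, rfl⟩, fun _ => ⟨LinearMap.toContinuousLinearMap l, ?_⟩,
    hdim⟩ ⟨hx, rfl⟩
  · exact hly.ne this.2
  · ext z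
    simp only [Set.mem_ofPred_eq, LinearMap.coe_toContinuousLinearMap']
    exact ⟨fun hz => ⟨hz.1, fun w hw => hz.2 ▸ hlQ w hw⟩,
      fun hz => ⟨hz.1, le_antisymm (hlQ z hz.1) (hz.2 x hx)⟩⟩

end Facets

/-! ### The lower bound. -/

theorem orient_lineMap (a b x y : EuclideanSpace ℝ (Fin 2)) (t : ℝ) :
    orient a b (AffineMap.lineMap x y t) = (1 - t) * orient a b x + t * orient a b y := by
  rw [AffineMap.lineMap_apply_module, orient_combination a b (by ring)]

theorem orient_midpoint_self (a b : EuclideanSpace ℝ (Fin 2)) :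
    orient a b (midpoint ℝ a b) = 0 := by
  rw [midpoint, orient_lineMap, orient_self_outer, orient_self_right]; ring

/-- A heptagon needs more than five labels if every vertex whose labels occur at one of the ends
of an edge allows the heptagon to be prolonged from this vertex across the edge. -/
theorem IsConvexHeptagon.five_lt_card {p : Fin 7 → EuclideanSpace ℝ (Fin 2)}
    (hp : IsConvexHeptagon p) {T : Type*} [Finite T] (A : Fin 7 → Set T)
    (hA : ∀ i j, A i ⊆ A j ∪ A (j + 1) → ∃ ε : ℝ, 0 < ε ∧
      AffineMap.lineMap (p i) (midpoint ℝ (p j) (p (j + 1))) (1 + ε) ∈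
        convexHull ℝ (Set.range p)) : 5 < Nat.card T := by
  by_contra! hT
  obtain ⟨i, j, hij, hij', hsub⟩ := exists_subset_union_of_card_le_five hT A
  obtain ⟨ε, hε, hmem⟩ := hA i j hsub
  rw [hp.convexHull_eq] at hmem
  have := hmem j
  rw [orient_lineMap, orient_midpoint_self] at this
  have := mul_pos hε (hp.orient_edge_pos hij hij')
  linarith

theorem exists_forall_nonneg_add_mul {ι : Type*} [Finite ι] (a b : ι → ℝ) (ha : ∀ i, 0 ≤ a i)
    (hab : ∀ i, a i = 0 → b i = 0) : ∃ ε : ℝ, 0 < ε ∧ ∀ i, 0 ≤ a i + ε * b i := by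
  have h : ∀ i, ∀ᶠ ε : ℝ in nhdsWithin 0 (Set.Ioi 0), 0 ≤ a i + ε * b i := by
    intro i
    rcases (ha i).eq_or_lt with h | h
    · rw [hab i h.symm, ← h]
      simp
    · have hc : Filter.Tendsto (fun ε : ℝ => a i + ε * b i) (nhds 0) (nhds (a i + 0 * b i)) :=
        Continuous.tendsto (by fun_prop) 0
      rw [zero_mul, add_zero] at hc
      exact ((hc.mono_left nhdsWithin_le_nhds).eventually (lt_mem_nhds h)).mono fun _ h => h.le
  obtain ⟨ε, h1, h2⟩ := ((Filter.eventually_all.2 h).and self_mem_nhdsWithin).exists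
  exact ⟨ε, h2, h1⟩

/-- Labels are the supports of convex weights. The averaged weights of `p j` and `p (j + 1)` are
positive on the union of their supports, so moving slightly away from the weights of `p i` keeps
them nonnegative; the moved point stays in `H` because `H` is affine. -/
theorem IsConvexHeptagon.five_lt_encard_vertexSet {p : Fin 7 → EuclideanSpace ℝ (Fin 2)}
    (hp : IsConvexHeptagon p) {d : ℕ} {Q : Set (EuclideanSpace ℝ (Fin d))} (hQ : IsPolytope Q)
    (hs : IsSectionOf (convexHull ℝ (Set.range p)) Q) : 5 < (vertexSet Q).encard := by
  classical
  obtain ⟨f, H, hf, hfH⟩ := hs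
  have hfin := hQ.finite_vertexSet
  have := hfin.to_subtype
  have hmem : ∀ i, f (p i) ∈ Q ∩ H := fun i => by
    rw [← hfH]; exact ⟨p i, subset_convexHull ℝ _ ⟨i, rfl⟩, rfl⟩
  have hQ' : Q = convexHull ℝ (hfin.toFinset : Set _) := by
    rw [hfin.coe_toFinset]; exact hQ.eq_convexHull_vertexSet
  have hw : ∀ i, ∃ w : EuclideanSpace ℝ (Fin d) → ℝ, (∀ y ∈ hfin.toFinset, 0 ≤ w y) ∧
      ∑ y ∈ hfin.toFinset, w y = 1 ∧ ∑ y ∈ hfin.toFinset, w y • y = f (p i) := fun i => by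
    rw [← Finset.mem_convexHull', ← hQ']
    exact (hmem i).1
  choose w hw0 hw1 hwp using hw
  have hcard : 5 < Nat.card (vertexSet Q) := by
    refine hp.five_lt_card (fun i => {t | w i t.1 ≠ 0}) fun i j hij => ?_
    obtain ⟨ε, hε, hnn⟩ := exists_forall_nonneg_add_mul
      (fun t : vertexSet Q => (w j t + w (j + 1) t) / 2)
      (fun t => (w j t + w (j + 1) t) / 2 - w i t)
      (fun t => by
        have h1 := hw0 j t (hfin.mem_toFinset.2 t.2)
        have h2 := hw0 (j + 1) t (hfin.mem_toFinset.2 t.2)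
        positivity)
      (fun t ht => by
        have h1 := hw0 j t (hfin.mem_toFinset.2 t.2)
        have h2 := hw0 (j + 1) t (hfin.mem_toFinset.2 t.2)
        have h3 : w i t = 0 := by
          by_contra hne
          rcases hij hne with h | h
          · exact h (by linarith)
          · exact h (by linarith)
        rw [ht, h3, sub_zero])
    refine ⟨ε, hε, ?_⟩
    have hpt : f (AffineMap.lineMap (p i) (midpoint ℝ (p j) (p (j + 1))) (1 + ε)) =
        AffineMap.lineMap (f (p i)) (midpoint ℝ (f (p j)) (f (p (j + 1)))) (1 + ε) := by
      rw [AffineMap.apply_lineMap, AffineMap.map_midpoint]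
    have hin : f (AffineMap.lineMap (p i) (midpoint ℝ (p j) (p (j + 1))) (1 + ε)) ∈ Q ∩ H := by
      refine ⟨?_, ?_⟩
      · rw [hQ', Finset.mem_convexHull']
        refine ⟨fun y => (w j y + w (j + 1) y) / 2 + ε * ((w j y + w (j + 1) y) / 2 - w i y),
          fun y hy => hnn ⟨y, hfin.mem_toFinset.1 hy⟩, ?_, ?_⟩
        · simp only [Finset.sum_add_distrib, ← Finset.mul_sum, Finset.sum_sub_distrib,
            ← Finset.sum_div, hw1]
          ring
        · rw [hpt, AffineMap.lineMap_apply_module, midpoint_eq_smul_add, ← hwp, ← hwp, ← hwp]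
          simp only [Finset.smul_sum, ← Finset.sum_add_distrib, smul_smul, ← add_smul]
          refine Finset.sum_congr rfl fun y _ => ?_
          congr 1
          rw [invOf_eq_inv]
          ring
      · rw [hpt]
        refine AffineMap.lineMap_mem _ (hmem i).2 ?_
        exact AffineMap.lineMap_mem _ (hmem j).2 (hmem (j + 1)).2
    rw [← hfH] at hin
    exact (hf.mem_set_image).1 hin
  rw [Nat.card_coe_set_eq] at hcard
  rw [← hfin.cast_ncard_eq]
  exact_mod_cast hcard

/-- Labels are the facets missing a lift `y i`. A facet through the midpoint of `y j` and `y (j +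
1)` contains both ends, hence by the inclusion of labels also `y i`; thus `exists_lineMap_mem`
applies. -/
theorem IsConvexHeptagon.five_lt_encard_facetSet {p : Fin 7 → EuclideanSpace ℝ (Fin 2)}
    (hp : IsConvexHeptagon p) {d : ℕ} {Q : Set (EuclideanSpace ℝ (Fin d))}
    (hQ : IsExtensionOf Q (convexHull ℝ (Set.range p))) : 5 < (facetSet Q).encard := by
  obtain ⟨hpoly, π, hπ⟩ := hQ
  by_cases hfin : (facetSet Q).Finite
  swap
  · rw [Set.Infinite.encard_eq hfin]; exact ENat.natCast_lt_top 5
  have := hfin.to_subtype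
  have hlift : ∀ i, ∃ y ∈ Q, π y = p i := fun i => by
    have : p i ∈ π '' Q := by rw [hπ]; exact subset_convexHull ℝ _ ⟨i, rfl⟩
    exact this
  choose y hyQ hyp using hlift
  have hcard : 5 < Nat.card (facetSet Q) := by
    refine hp.five_lt_card (fun i => {F | y i ∉ F.1}) fun i j hij => ?_
    have hm : midpoint ℝ (y j) (y (j + 1)) ∈ Q := hpoly.convex.midpoint_mem (hyQ j) (hyQ (j + 1))
    obtain ⟨ε, hε, hmem⟩ := hpoly.exists_lineMap_mem hm (hyQ i) (by
      intro F hF hmF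
      by_contra hi
      have hext := (hF.2.1).isExtreme
      have hends : y j ∈ F ∧ y (j + 1) ∈ F := by
        have hopen : midpoint ℝ (y j) (y (j + 1)) ∈ openSegment ℝ (y j) (y (j + 1)) :=
          midpoint_mem_openSegment _ _
        exact ⟨hext.left_mem_of_mem_openSegment (hyQ j) (hyQ (j + 1)) hmF hopen,
          hext.right_mem_of_mem_openSegment (hyQ j) (hyQ (j + 1)) hmF hopen⟩
      rcases @hij ⟨F, hF⟩ hi with h | h
      · exact h hends.1
      · exact h hends.2)
    refine ⟨ε, hε, ?_⟩
    rw [← hπ]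
    refine ⟨_, hmem, ?_⟩
    have := AffineMap.apply_lineMap π.toAffineMap (y i) (midpoint ℝ (y j) (y (j + 1))) (1 + ε)
    rw [AffineMap.map_midpoint] at this
    simp only [LinearMap.coe_toAffineMap, hyp] at this
    exact this
  rw [Nat.card_coe_set_eq] at hcard
  rw [← hfin.cast_ncard_eq]
  exact_mod_cast hcard

/-! ### From sections to extensions: slices of the nonnegative orthant. -/

section NonnegativeSection

variable {m : ℕ} (L : AffineSubspace ℝ (EuclideanSpace ℝ (Fin m)))

/-- The intersection of an affine subspace with the nonnegative orthant. -/
def nonnegPart : Set (EuclideanSpace ℝ (Fin m)) := {w | w ∈ L ∧ ∀ k, 0 ≤ w k}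

variable {L}

theorem convex_nonnegPart : Convex ℝ (nonnegPart L) := by
  intro x hx y hy s t hs ht hst
  refine ⟨L.convex hx.1 hy.1 hs ht hst, fun k => ?_⟩
  have h1 := hx.2 k
  have h2 := hy.2 k
  simp only [PiLp.add_apply, PiLp.smul_apply, smul_eq_mul]
  positivity

theorem exists_lineMap_mem_nonnegPart {x y : EuclideanSpace ℝ (Fin m)} (hx : x ∈ nonnegPart L)
    (hy : y ∈ nonnegPart L) (h : ∀ k, x k = 0 → y k = 0) :
    ∃ ε : ℝ, 0 < ε ∧ AffineMap.lineMap y x (1 + ε) ∈ nonnegPart L := by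
  obtain ⟨ε, hε, hnn⟩ := exists_forall_nonneg_add_mul (fun k => x k) (fun k => x k - y k) hx.2
    (fun k hk => by rw [hk, h k hk, sub_zero])
  refine ⟨ε, hε, AffineMap.lineMap_mem _ hy.1 hx.1, fun k => ?_⟩
  have := hnn k
  simp only [AffineMap.lineMap_apply_module, PiLp.add_apply, PiLp.smul_apply, smul_eq_mul]
  linarith

/-- An extreme point is determined by its zero coordinates: if they also vanish at `y`, the segment
from `y` can be prolonged beyond it, forcing equality. Hence there are finitely many extreme points.
-/
theorem isPolytope_nonnegPart (hb : Bornology.IsBounded (nonnegPart L)) :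
    IsPolytope (nonnegPart L) := by
  have hclosed : IsClosed (nonnegPart L) := by
    have h : nonnegPart L = (L : Set _) ∩ ⋂ k, {w | 0 ≤ w k} := by
      ext w; simp [nonnegPart]
    rw [h]
    refine L.closed_of_finiteDimensional.inter (isClosed_iInter fun k => ?_)
    exact isClosed_le continuous_const (by fun_prop)
  have hfin : (vertexSet (nonnegPart L)).Finite := by
    refine Set.Finite.of_injOn (f := fun w => {k | w k = 0}) (t := Set.univ)
      (fun _ _ => Set.mem_univ _) ?_ Set.finite_univ
    intro x hx y hy hxy
    have hxy' : ∀ k, x k = 0 → y k = 0 := fun k hk =>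
      (Set.ext_iff.1 hxy k).1 hk
    obtain ⟨ε, hε, hmem⟩ := exists_lineMap_mem_nonnegPart hx.1 hy.1 hxy'
    refine ((mem_extremePoints_iff_left.1 hx).2 y hy.1 _ hmem ?_).symm
    refine ⟨ε / (1 + ε), 1 / (1 + ε), by positivity, by positivity, by field_simp; ring, ?_⟩
    rw [AffineMap.lineMap_apply_module]
    ext k
    simp only [PiLp.add_apply, PiLp.smul_apply, smul_eq_mul]
    field_simp
    ring
  exact ⟨_, hfin, IsCompact.eq_convexHull_vertexSet
    (Metric.isCompact_of_isClosed_isBounded hclosed hb) convex_nonnegPart hfin⟩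

/-- The midpoint of two nonnegative points vanishes only where both do, so a point with the fewest
zeros has only zeros common to all of `F`. It plays the part of a relative interior point. -/
theorem exists_min_zeros {F : Set (EuclideanSpace ℝ (Fin m))} (hF : F.Nonempty)
    (hc : Convex ℝ F) (hsub : F ⊆ nonnegPart L) :
    ∃ x ∈ F, ∀ z ∈ F, ∀ k, x k = 0 → z k = 0 := by
  classical
  let zeros : EuclideanSpace ℝ (Fin m) → Finset (Fin m) := fun w => Finset.univ.filter (w · = 0)
  obtain ⟨x, hx, hmin⟩ := exists_minimalFor_of_wellFoundedLT (· ∈ F)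
    (fun w => (zeros w).card) hF
  refine ⟨x, hx, fun z hz k hk => ?_⟩
  have hmid : midpoint ℝ x z ∈ F := hc.midpoint_mem hx hz
  have hcoord : ∀ k, midpoint ℝ x z k = 2⁻¹ * x k + 2⁻¹ * z k := by
    intro k
    rw [midpoint_eq_smul_add, invOf_eq_inv]
    simp
  have hzero : ∀ k, midpoint ℝ x z k = 0 → x k = 0 ∧ z k = 0 := by
    intro k h
    have h1 := (hsub hx).2 k
    have h2 := (hsub hz).2 k
    rw [hcoord] at h
    constructor <;> linarith
  have hss : zeros (midpoint ℝ x z) ⊆ zeros x := fun k h => by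
    simp only [zeros, Finset.mem_filter, Finset.mem_univ, true_and] at h ⊢
    exact (hzero k h).1
  have heq := Finset.eq_of_subset_of_card_le hss (hmin hmid (Finset.card_le_card hss))
  have : k ∈ zeros (midpoint ℝ x z) := by
    rw [heq]; simpa [zeros] using hk
  exact (hzero k (by simpa [zeros] using this)).2

/-- Take `x` in the facet `F` with fewest zeros and `y` outside `F`. Some coordinate `k` vanishes at
`x` but not at `y`, otherwise prolonging from `y` beyond `x` would exceed the maximum of `l`. The
coordinate face of `k` contains `F` and is of smaller dimension than the whole, so both have the
same span; `l` is constant along it, which makes them equal. -/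
theorem facetSet_nonnegPart_subset :
    facetSet (nonnegPart L) ⊆ Set.range fun k : Fin m => {w ∈ nonnegPart L | w k = 0} := by
  rintro F ⟨hne, hexp, hdim⟩
  have hsub : F ⊆ nonnegPart L := hexp.subset
  obtain ⟨l, hl⟩ := hexp hne
  obtain ⟨x, hxF, hmin⟩ := exists_min_zeros hne (hexp.convex convex_nonnegPart) hsub
  have hlx : ∀ w ∈ nonnegPart L, l w ≤ l x := by
    rw [hl] at hxF; exact hxF.2
  have hF : ∀ w, w ∈ F ↔ w ∈ nonnegPart L ∧ l w = l x := by
    intro w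
    conv_lhs => rw [hl]
    exact ⟨fun h => ⟨h.1, le_antisymm (hlx w h.1) (h.2 x (hsub hxF))⟩,
      fun h => ⟨h.1, fun z hz => h.2 ▸ hlx z hz⟩⟩
  obtain ⟨y, hy, hyF⟩ : ∃ y ∈ nonnegPart L, y ∉ F := by
    by_contra! h
    rw [Set.Subset.antisymm hsub h] at hdim
    omega
  have hly : l y < l x := lt_of_le_of_ne (hlx y hy) fun h => hyF ((hF y).2 ⟨hy, h⟩)
  obtain ⟨k, hxk, hyk⟩ : ∃ k, x k = 0 ∧ y k ≠ 0 := by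
    by_contra! h
    obtain ⟨ε, hε, hmem⟩ := exists_lineMap_mem_nonnegPart (hsub hxF) hy h
    have := hlx _ hmem
    rw [AffineMap.lineMap_apply_module, map_add, map_smul, map_smul, smul_eq_mul,
      smul_eq_mul] at this
    nlinarith
  refine ⟨k, Set.Subset.antisymm ?_ ?_⟩
  swap
  · exact fun z hz => ⟨hsub hz, hmin z hz k hxk⟩
  have hFG : F ⊆ {w ∈ nonnegPart L | w k = 0} := fun z hz => ⟨hsub hz, hmin z hz k hxk⟩
  have hGW : vectorSpan ℝ {w ∈ nonnegPart L | w k = 0} < vectorSpan ℝ (nonnegPart L) := by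
    refine lt_of_le_of_ne (vectorSpan_mono ℝ fun z hz => hz.1) fun h => ?_
    have hle : vectorSpan ℝ {w ∈ nonnegPart L | w k = 0} ≤
        LinearMap.ker (EuclideanSpace.proj (𝕜 := ℝ) k).toLinearMap := by
      rw [vectorSpan_le_iff_of_mem (hFG hxF)]
      intro z hz
      simp [hz.2, hxk]
    have hmem : y - x ∈ vectorSpan ℝ {w ∈ nonnegPart L | w k = 0} := by
      rw [h]; exact vsub_mem_vectorSpan ℝ hy (hsub hxF)
    have := hle hmem
    simp [hxk, hyk] at this
  have hspan : vectorSpan ℝ F = vectorSpan ℝ {w ∈ nonnegPart L | w k = 0} := by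
    refine Submodule.eq_of_le_of_finrank_le (vectorSpan_mono ℝ hFG) ?_
    have := Submodule.finrank_lt_finrank_of_lt hGW
    unfold polyDim at hdim
    omega
  have hker : vectorSpan ℝ F ≤ LinearMap.ker l.toLinearMap := by
    rw [vectorSpan_le_iff_of_mem hxF]
    intro z hz
    simp [((hF z).1 hz).2]
  intro z hz
  refine (hF z).2 ⟨hz.1, ?_⟩
  have : z - x ∈ vectorSpan ℝ F := by
    rw [hspan]; exact vsub_mem_vectorSpan ℝ hz (hFG hxF)
  have := hker this
  simpa [sub_eq_zero] using this

theorem encard_facetSet_nonnegPart_le : (facetSet (nonnegPart L)).encard ≤ m := by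
  refine (Set.encard_le_encard facetSet_nonnegPart_subset).trans ?_
  rw [← Set.image_univ]
  refine (Set.encard_image_le _ _).trans ?_
  simp

end NonnegativeSection

theorem mem_convexHull_range_iff {E : Type*} [AddCommGroup E] [Module ℝ E] {m : ℕ}
    {q : Fin m → E} {x : E} : x ∈ convexHull ℝ (Set.range q) ↔
      ∃ w : Fin m → ℝ, (∀ k, 0 ≤ w k) ∧ ∑ k, w k = 1 ∧ ∑ k, w k • q k = x := by
  classical
  constructor
  · intro hx
    refine convexHull_min (t := {x | ∃ w : Fin m → ℝ, (∀ k, 0 ≤ w k) ∧ ∑ k, w k = 1 ∧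
      ∑ k, w k • q k = x}) ?_ ?_ hx
    · rintro _ ⟨k, rfl⟩
      refine ⟨Pi.single k 1, fun j => ?_, by simp, by simp [Pi.single_apply]⟩
      by_cases h : j = k
      · subst h; simp
      · simp [h]
    · rintro x ⟨w, hw, hw1, rfl⟩ y ⟨w', hw', hw1', rfl⟩ s t hs ht hst
      refine ⟨fun k => s * w k + t * w' k, fun k => ?_, ?_, ?_⟩
      · have := hw k; have := hw' k; positivity
      · simp only [Finset.sum_add_distrib, ← Finset.mul_sum, hw1, hw1']; linarith
      · simp only [add_smul, Finset.sum_add_distrib, mul_smul, ← Finset.smul_sum]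
  · rintro ⟨w, hw, hw1, rfl⟩
    exact (convex_convexHull ℝ _).sum_mem (fun k _ => hw k) hw1
      fun k _ => subset_convexHull ℝ _ ⟨k, rfl⟩

/-- A section of a polytope with `m` vertices has an extension with at most `m` facets. -/
theorem IsSectionOf.exists_isExtensionOf {k d m : ℕ} {P : Set (EuclideanSpace ℝ (Fin k))}
    {q : Fin m → EuclideanSpace ℝ (Fin d)} (h : IsSectionOf P (convexHull ℝ (Set.range q))) :
    ∃ W : Set (EuclideanSpace ℝ (Fin m)), IsExtensionOf W P ∧ (facetSet W).encard ≤ m := by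
  obtain ⟨f, H, hf, hfH⟩ := h
  obtain ⟨g, hg⟩ := LinearMap.exists_leftInverse_of_injective f.linear
    (LinearMap.ker_eq_bot.2 (f.linear_injective_iff.2 hf))
  have hgf : ∀ x, g (f x) - g (f 0) = x := by
    intro x
    rw [← map_sub]
    have : f x - f 0 = f.linear x := by
      have := f.linearMap_vsub x 0
      simpa using this.symm
    rw [this]
    exact LinearMap.congr_fun hg x
  let Φ : EuclideanSpace ℝ (Fin m) →ₗ[ℝ] EuclideanSpace ℝ (Fin d) :=
    ∑ k, (EuclideanSpace.proj (𝕜 := ℝ) k).toLinearMap.smulRight (q k)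
  let S : EuclideanSpace ℝ (Fin m) →ₗ[ℝ] ℝ := ∑ k, (EuclideanSpace.proj (𝕜 := ℝ) k).toLinearMap
  have hΦ : ∀ w, Φ w = ∑ k, w k • q k := fun w => by simp [Φ]
  have hS : ∀ w, S w = ∑ k, w k := fun w => by simp [S]
  -- The nonnegative points of `L` are the convex weights whose combination of the `q k` lies in
  -- `H`.
  let L : AffineSubspace ℝ (EuclideanSpace ℝ (Fin m)) :=
    H.comap Φ.toAffineMap ⊓ (affineSpan ℝ {(1 : ℝ)}).comap S.toAffineMap
  have hL : ∀ w, w ∈ nonnegPart L ↔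
      (∑ k, w k • q k ∈ H ∧ ∑ k, w k = 1) ∧ ∀ k, 0 ≤ w k := by
    intro w
    simp [nonnegPart, L, AffineSubspace.mem_inf_iff, AffineSubspace.mem_comap, hΦ, hS,
      AffineSubspace.mem_affineSpan_singleton]
  have hbdd : Bornology.IsBounded (nonnegPart L) := by
    rw [isBounded_iff_forall_norm_le]
    refine ⟨√m, fun w hw => ?_⟩
    obtain ⟨⟨-, hsum⟩, hnn⟩ := (hL w).1 hw
    rw [EuclideanSpace.norm_eq]
    apply Real.sqrt_le_sqrt
    calc ∑ k, ‖w k‖ ^ 2 ≤ ∑ k : Fin m, (1 : ℝ) := by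
          refine Finset.sum_le_sum fun k _ => ?_
          have h1 : w k ≤ 1 := by
            rw [← hsum]
            exact Finset.single_le_sum (fun k _ => hnn k) (Finset.mem_univ k)
          rw [Real.norm_of_nonneg (hnn k)]
          exact pow_le_one₀ (hnn k) h1
      _ = m := by simp
  -- The affine inverse of `f` has constant term `-g (f 0)`; multiplying it by the coordinate sum
  -- `S`, which is `1` on `L`, makes the map linear.
  let π : EuclideanSpace ℝ (Fin m) →ₗ[ℝ] EuclideanSpace ℝ (Fin k) :=
    g ∘ₗ Φ - S.smulRight (g (f 0))
  have hπ : ∀ w x, ∑ k, w k = 1 → ∑ k, w k • q k = f x → π w = x := by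
    intro w x h1 h2
    simp only [π, LinearMap.sub_apply, LinearMap.comp_apply, LinearMap.smulRight_apply, hΦ, hS,
      h1, h2, one_smul, hgf]
  refine ⟨nonnegPart L, ⟨isPolytope_nonnegPart hbdd, π, ?_⟩, encard_facetSet_nonnegPart_le⟩
  apply Set.Subset.antisymm
  · rintro _ ⟨w, hw, rfl⟩
    obtain ⟨⟨hH, hsum⟩, hnn⟩ := (hL w).1 hw
    have hmem : ∑ k, w k • q k ∈ f '' P := by
      rw [hfH]
      exact ⟨mem_convexHull_range_iff.2 ⟨_, hnn, hsum, rfl⟩, hH⟩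
    obtain ⟨x, hx, hfx⟩ := hmem
    rwa [hπ w x hsum hfx.symm]
  · intro x hx
    have hmem : f x ∈ convexHull ℝ (Set.range q) ∩ H := by
      rw [← hfH]; exact ⟨x, hx, rfl⟩
    obtain ⟨w, hw, hw1, hwx⟩ := mem_convexHull_range_iff.1 hmem.1
    refine ⟨WithLp.toLp 2 w, (hL _).2 ⟨⟨?_, hw1⟩, hw⟩, hπ _ _ hw1 hwx⟩
    change ∑ k, w k • q k ∈ H
    rw [hwx]
    exact hmem.2

/-! ### Existence of a vertex satisfying both pivot inequalities. -/

section Pivot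

variable {p : Fin 7 → EuclideanSpace ℝ (Fin 2)}

/-- The first of two inequalities making the vertex `p k` of a heptagon suitable as the pivot of a
lift. -/
def IsLeftPivot (p : Fin 7 → EuclideanSpace ℝ (Fin 2)) (k : Fin 7) : Prop :=
  orient (p k) (p (k + 1)) (p (k + 2)) * orient (p (k + 4)) (p (k + 5)) (p (k + 6)) ≤
    orient (p (k + 5)) (p (k + 6)) (p k) * orient (p (k + 1)) (p (k + 2)) (p (k + 4))

/-- The mirror image of `IsLeftPivot`. -/
def IsRightPivot (p : Fin 7 → EuclideanSpace ℝ (Fin 2)) (k : Fin 7) : Prop :=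
  orient (p (k + 5)) (p (k + 6)) (p k) * orient (p (k + 1)) (p (k + 2)) (p (k + 3)) ≤
    orient (p k) (p (k + 1)) (p (k + 2)) * orient (p (k + 3)) (p (k + 5)) (p (k + 6))

theorem IsConvexHeptagon.orient_add_pos (hp : IsConvexHeptagon p) (r a b c : Fin 7)
    (h : a < b ∧ b < c ∨ b < c ∧ c < a ∨ c < a ∧ a < b) :
    0 < orient (p (r + a)) (p (r + b)) (p (r + c)) :=
  (hp.rotate r).orient_pos h

/-- Write `[abc]` for the orientation of `p (k + a), p (k + b), p (k + c)`. If both inequalities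
fail, their product, after cancelling `[012][123]`, reads `[356][450] < [560][345]`, against the
Plücker relation at `p (k + 5)`. -/
theorem IsConvexHeptagon.isLeftPivot_or_isRightPivot (hp : IsConvexHeptagon p) (k : Fin 7) :
    IsRightPivot p k ∨ IsLeftPivot p (k + 3) := by
  by_contra! h
  obtain ⟨h1, h2⟩ := h
  unfold IsRightPivot at h1
  unfold IsLeftPivot at h2
  simp only [add_assoc, Fin.isValue, Fin.reduceAdd] at h1 h2
  rw [add_zero] at h2
  have pos := hp.orient_add_pos k
  have p012 := pos 0 1 2 (by decide)
  have p123 := pos 1 2 3 (by decide)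
  have p564 := pos 5 6 4 (by decide)
  have p503 := pos 5 0 3 (by decide)
  simp only [add_zero] at p012 p503
  have plucker := orient_mul_orient (p (k + 5)) (p (k + 6)) (p k) (p (k + 3)) (p (k + 4))
  rw [orient_rotate (p (k + 3)) (p (k + 5)) (p (k + 6)),
    orient_rotate (p (k + 4)) (p (k + 5)) (p k),
    orient_rotate (p (k + 4)) (p (k + 5)) (p (k + 3)),
    orient_rotate (p (k + 3)) (p (k + 4)) (p (k + 5))] at plucker
  have hpos := mul_pos p564 p503
  have h3 := mul_lt_mul'' (not_le.1 h1) (not_le.1 h2)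
    (mul_nonneg p012.le (by simpa using (pos 3 5 6 (by decide)).le))
    (mul_nonneg p123.le (by simpa using (pos 4 5 0 (by decide)).le))
  have h4 := mul_pos p012 p123
  nlinarith

theorem prod_add_right (f : Fin 7 → ℝ) (a : Fin 7) : ∏ k, f (k + a) = ∏ k, f k :=
  Equiv.prod_comp (Equiv.addRight a) f

/-- Multiply over the cyclic index. If the inequality fails everywhere, then `∏ Y < ∏ X`; but
Plücker gives `X k * Z (k + 3) ≤ Y k * Z (k + 5)`, and the shifts disappear in the product, leaving
`∏ X ≤ ∏ Y`. -/
theorem IsConvexHeptagon.exists_isLeftPivot (hp : IsConvexHeptagon p) :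
    ∃ k, IsLeftPivot p k := by
  by_contra! h
  let X : Fin 7 → ℝ := fun k => orient (p k) (p (k + 1)) (p (k + 2))
  let Y : Fin 7 → ℝ := fun k => orient (p k) (p (k + 1)) (p (k + 3))
  let Z : Fin 7 → ℝ := fun k => orient (p k) (p (k + 2)) (p (k + 4))
  have hX : ∀ k, 0 < X k := fun k => by simpa using hp.orient_add_pos k 0 1 2 (by decide)
  have hY : ∀ k, 0 < Y k := fun k => by simpa using hp.orient_add_pos k 0 1 3 (by decide)
  have hZ : ∀ k, 0 < Z k := fun k => by simpa using hp.orient_add_pos k 0 2 4 (by decide)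
  have h1 : ∏ k, X (k + 5) * Y (k + 1) < ∏ k, X k * X (k + 4) := by
    refine Finset.prod_lt_prod_of_nonempty (fun k _ => mul_pos (hX _) (hY _)) (fun k _ => ?_)
      Finset.univ_nonempty
    have := not_le.1 (h k)
    simpa [X, Y, add_assoc] using this
  have h2 : ∏ k, X k * Z (k + 3) ≤ ∏ k, Y k * Z (k + 5) := by
    refine Finset.prod_le_prod (fun k _ => (mul_pos (hX _) (hZ _)).le) (fun k _ => ?_)
    have plucker := orient_mul_orient (p k) (p (k + 1)) (p (k + 2)) (p (k + 3)) (p (k + 5))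
    have p015 := hp.orient_add_pos k 0 1 5 (by decide)
    have p023 := hp.orient_add_pos k 0 2 3 (by decide)
    simp only [add_zero] at p015 p023
    have := mul_pos p015 p023
    rw [orient_rotate (p (k + 5)) (p k) (p (k + 2))] at plucker
    simp only [X, Y, Z, add_assoc, Fin.isValue, Fin.reduceAdd, add_zero]
    rw [orient_rotate (p k) (p (k + 3)) (p (k + 5))]
    linarith
  simp only [Finset.prod_mul_distrib, prod_add_right] at h1 h2
  have hXp : 0 < ∏ k, X k := Finset.prod_pos fun k _ => hX k
  have hZp : 0 < ∏ k, Z k := Finset.prod_pos fun k _ => hZ k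
  have h3 := lt_of_mul_lt_mul_left h1 hXp.le
  have h4 := le_of_mul_le_mul_right h2 hZp
  linarith

theorem IsConvexHeptagon.exists_isRightPivot (hp : IsConvexHeptagon p) :
    ∃ k, IsRightPivot p k := by
  by_contra! h
  let X : Fin 7 → ℝ := fun k => orient (p k) (p (k + 1)) (p (k + 2))
  let Y : Fin 7 → ℝ := fun k => orient (p k) (p (k + 2)) (p (k + 3))
  let Z : Fin 7 → ℝ := fun k => orient (p k) (p (k + 2)) (p (k + 4))
  have hX : ∀ k, 0 < X k := fun k => by simpa using hp.orient_add_pos k 0 1 2 (by decide)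
  have hY : ∀ k, 0 < Y k := fun k => by simpa using hp.orient_add_pos k 0 2 3 (by decide)
  have hZ : ∀ k, 0 < Z k := fun k => by simpa using hp.orient_add_pos k 0 2 4 (by decide)
  have h1 : ∏ k, X k * Y (k + 3) < ∏ k, X (k + 5) * X (k + 1) := by
    refine Finset.prod_lt_prod_of_nonempty (fun k _ => mul_pos (hX _) (hY _)) (fun k _ => ?_)
      Finset.univ_nonempty
    have := not_le.1 (h k)
    simpa [X, Y, add_assoc] using this
  have h2 : ∏ k, X (k + 5) * Z k ≤ ∏ k, Y (k + 4) * Z (k + 5) := by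
    refine Finset.prod_le_prod (fun k _ => (mul_pos (hX _) (hZ _)).le) (fun k _ => ?_)
    have plucker := orient_mul_orient (p k) (p (k + 2)) (p (k + 4)) (p (k + 5)) (p (k + 6))
    have p026 := hp.orient_add_pos k 0 2 6 (by decide)
    have p045 := hp.orient_add_pos k 0 4 5 (by decide)
    simp only [add_zero] at p026 p045
    have := mul_pos p026 p045
    rw [orient_rotate (p (k + 5)) (p k) (p (k + 2))] at plucker
    simp only [X, Y, Z, add_assoc, Fin.isValue, Fin.reduceAdd, add_zero]
    rw [orient_rotate (p k) (p (k + 4)) (p (k + 6)), orient_rotate (p k) (p (k + 5)) (p (k + 6))]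
    linarith
  simp only [Finset.prod_mul_distrib, prod_add_right] at h1 h2
  have hXp : 0 < ∏ k, X k := Finset.prod_pos fun k _ => hX k
  have hZp : 0 < ∏ k, Z k := Finset.prod_pos fun k _ => hZ k
  have h3 := lt_of_mul_lt_mul_left h1 hXp.le
  have h4 := le_of_mul_le_mul_right h2 hZp
  linarith

/-- If no vertex is both, failure of the right condition at `k` forces the left one at `k + 3`,
hence failure of the right one there. Since `3` generates `ℤ/7`, one failure would exclude all right
pivots. -/
theorem IsConvexHeptagon.exists_isLeftPivot_and_isRightPivot (hp : IsConvexHeptagon p) :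
    ∃ k, IsLeftPivot p k ∧ IsRightPivot p k := by
  by_contra! h
  have step : ∀ k, ¬ IsRightPivot p k → ¬ IsRightPivot p (k + 3) := fun k hk =>
    h _ ((hp.isLeftPivot_or_isRightPivot k).resolve_left hk)
  obtain ⟨k, hk⟩ := hp.exists_isLeftPivot
  have hk0 := h k hk
  obtain ⟨j, hj⟩ := hp.exists_isRightPivot
  have hk1 := step _ hk0
  have hk2 := step _ hk1
  have hk3 := step _ hk2
  have hk4 := step _ hk3
  have hk5 := step _ hk4
  have hk6 := step _ hk5
  have hj' : j = k ∨ j = k + 3 ∨ j = k + 3 + 3 ∨ j = k + 3 + 3 + 3 ∨ j = k + 3 + 3 + 3 + 3 ∨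
      j = k + 3 + 3 + 3 + 3 + 3 ∨ j = k + 3 + 3 + 3 + 3 + 3 + 3 := by
    clear * -
    revert j k
    decide +kernel
  rcases hj' with h | h | h | h | h | h | h <;> rw [h] at hj
  exacts [hk0 hj, hk1 hj, hk2 hj, hk3 hj, hk4 hj, hk5 hj, hk6 hj]

end Pivot

/-! ### Lifting sums of homogeneous vectors to six points of space. -/

section Lift

/-- The linear functional on homogeneous coordinates extending `orient c d`. -/
def homOrient (c d : EuclideanSpace ℝ (Fin 2)) (a : ℝ × EuclideanSpace ℝ (Fin 2)) : ℝ :=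
  a.1 * (c 0 * d 1 - c 1 * d 0) + (d 0 - c 0) * a.2 1 - (d 1 - c 1) * a.2 0

theorem homOrient_one (c d x : EuclideanSpace ℝ (Fin 2)) :
    homOrient c d (1, x) = orient c d x := by
  simp only [homOrient, orient]; ring

theorem homOrient_add (c d : EuclideanSpace ℝ (Fin 2)) (a b : ℝ × EuclideanSpace ℝ (Fin 2)) :
    homOrient c d (a + b) = homOrient c d a + homOrient c d b := by
  simp only [homOrient, Prod.fst_add, Prod.snd_add, PiLp.add_apply]; ring

theorem homOrient_sub (c d : EuclideanSpace ℝ (Fin 2)) (a b : ℝ × EuclideanSpace ℝ (Fin 2)) :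
    homOrient c d (a - b) = homOrient c d a - homOrient c d b := by
  simp only [homOrient, Prod.fst_sub, Prod.snd_sub, PiLp.sub_apply]; ring

theorem homOrient_smul (c d : EuclideanSpace ℝ (Fin 2)) (t : ℝ)
    (a : ℝ × EuclideanSpace ℝ (Fin 2)) : homOrient c d (t • a) = t * homOrient c d a := by
  simp only [homOrient, Prod.smul_fst, Prod.smul_snd, PiLp.smul_apply, smul_eq_mul]; ring

/-- The point of space with homogeneous coordinates `a`, at height `s` before dehomogenization. -/
noncomputable def liftPoint (s : ℝ) (a : ℝ × EuclideanSpace ℝ (Fin 2)) :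
    EuclideanSpace ℝ (Fin 3) :=
  !₂[a.2 0 / a.1, a.2 1 / a.1, s / a.1]

/-- The inclusion of the plane as the horizontal coordinate plane of space. -/
noncomputable def planeInclusion :
    EuclideanSpace ℝ (Fin 2) →ₗ[ℝ] EuclideanSpace ℝ (Fin 3) where
  toFun x := !₂[x 0, x 1, 0]
  map_add' x y := by ext i; fin_cases i <;> simp
  map_smul' t x := by ext i; fin_cases i <;> simp

theorem planeInclusion_apply (x : EuclideanSpace ℝ (Fin 2)) :
    planeInclusion x = !₂[x 0, x 1, 0] := rfl

theorem planeInclusion_injective : Function.Injective planeInclusion := by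
  intro x y h
  have h0 := congrArg (fun z : EuclideanSpace ℝ (Fin 3) => z 0) h
  have h1 := congrArg (fun z : EuclideanSpace ℝ (Fin 3) => z 1) h
  ext i; fin_cases i
  · simpa [planeInclusion_apply] using h0
  · simpa [planeInclusion_apply] using h1

variable {p : Fin 7 → EuclideanSpace ℝ (Fin 2)} {a b : Fin 3 → ℝ × EuclideanSpace ℝ (Fin 2)}

/-- The heights `1 / a.1` and `-1 / b.1` cancel under weights proportional to `a.1` and `b.1`, so
the segment crosses the plane at the point represented by `a + b`. -/
theorem planeInclusion_eq_combination {a b : ℝ × EuclideanSpace ℝ (Fin 2)} (ha : 0 < a.1)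
    (hb : 0 < b.1) {t : ℝ} {x : EuclideanSpace ℝ (Fin 2)} (ht : 0 < t)
    (h : a + b = t • ((1 : ℝ), x)) :
    planeInclusion x = (a.1 / t) • liftPoint 1 a + (b.1 / t) • liftPoint (-1) b := by
  have h0 : a.2 0 + b.2 0 = t * x 0 := by
    have := congrArg (fun z : ℝ × EuclideanSpace ℝ (Fin 2) => z.2 0) h; simpa using this
  have h1 : a.2 1 + b.2 1 = t * x 1 := by
    have := congrArg (fun z : ℝ × EuclideanSpace ℝ (Fin 2) => z.2 1) h; simpa using this
  ext i; fin_cases i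
  · simp [planeInclusion_apply, liftPoint]; field_simp; linarith
  · simp [planeInclusion_apply, liftPoint]; field_simp; linarith
  · simp [planeInclusion_apply, liftPoint]; field_simp; ring

theorem planeInclusion_mem_of_sum (ha : ∀ i, 0 < (a i).1) (hb : ∀ j, 0 < (b j).1)
    (hpts : ∀ k, ∃ i j, ∃ t : ℝ, 0 < t ∧ a i + b j = t • ((1 : ℝ), p k)) (k : Fin 7) :
    planeInclusion (p k) ∈ convexHull ℝ
      (Set.range (Fin.append (fun i => liftPoint 1 (a i)) fun j => liftPoint (-1) (b j))) := by
  obtain ⟨i, j, t, ht, h⟩ := hpts k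
  rw [planeInclusion_eq_combination (ha i) (hb j) ht h]
  have hsum : (a i).1 + (b j).1 = t := by
    have := congrArg Prod.fst h; simpa using this
  refine convex_convexHull ℝ _
    (subset_convexHull ℝ _ (Set.mem_range.2 ⟨Fin.castAdd 3 i, Fin.append_left _ _ i⟩))
    (subset_convexHull ℝ _ (Set.mem_range.2 ⟨Fin.natAdd 3 j, Fin.append_right _ _ j⟩))
    (div_pos (ha i) ht).le (div_pos (hb j) ht).le ?_
  rw [← add_div, hsum, div_self ht.ne']

theorem IsConvexHeptagon.isSectionOf_lift (hp : IsConvexHeptagon p) (ha : ∀ i, 0 < (a i).1)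
    (hb : ∀ j, 0 < (b j).1)
    (hpts : ∀ k, ∃ i j, ∃ t : ℝ, 0 < t ∧ a i + b j = t • ((1 : ℝ), p k))
    (hedge : ∀ e i j, 0 ≤ homOrient (p e) (p (e + 1)) (a i + b j)) :
    IsSectionOf (convexHull ℝ (Set.range p)) (convexHull ℝ
      (Set.range (Fin.append (fun i => liftPoint 1 (a i)) fun j => liftPoint (-1) (b j)))) := by
  set q := Fin.append (fun i => liftPoint 1 (a i)) fun j => liftPoint (-1) (b j) with hq
  refine ⟨planeInclusion.toAffineMap,
    (LinearMap.ker (EuclideanSpace.proj (𝕜 := ℝ) (2 : Fin 3)).toLinearMap).toAffineSubspace,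
    planeInclusion_injective, Set.Subset.antisymm ?_ ?_⟩
  · rintro _ ⟨x, hx, rfl⟩
    refine ⟨?_, ?_⟩
    · refine convexHull_min (t := planeInclusion ⁻¹' convexHull ℝ (Set.range q)) ?_
        ((convex_convexHull ℝ _).linear_preimage _) hx
      rintro _ ⟨k, rfl⟩
      exact planeInclusion_mem_of_sum ha hb hpts k
    · simp [planeInclusion_apply]
  · rintro z ⟨hz, hz2⟩
    have hz2 : z 2 = 0 := by simpa using hz2
    refine ⟨!₂[z 0, z 1], ?_, ?_⟩
    swap
    · ext i; fin_cases i <;> simp [planeInclusion_apply, hz2]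
    rw [hp.convexHull_eq]
    intro e
    obtain ⟨i₀, hi₀⟩ := Finite.exists_min fun i => homOrient (p e) (p (e + 1)) (a i)
    -- Each edge inequality extends to space with slope `-c` in the height. Minimality of `c` makes
    -- it valid at the upper points, and `hedge e i₀` at the lower ones.
    set c := homOrient (p e) (p (e + 1)) (a i₀) with hc
    let l : EuclideanSpace ℝ (Fin 3) →ₗ[ℝ] ℝ :=
      (p (e + 1) 0 - p e 0) • (EuclideanSpace.proj (𝕜 := ℝ) (1 : Fin 3)).toLinearMap -
      (p (e + 1) 1 - p e 1) • (EuclideanSpace.proj (𝕜 := ℝ) (0 : Fin 3)).toLinearMap -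
      c • (EuclideanSpace.proj (𝕜 := ℝ) (2 : Fin 3)).toLinearMap
    have hl : ∀ z, l z = (p (e + 1) 0 - p e 0) * z 1 - (p (e + 1) 1 - p e 1) * z 0 - c * z 2 :=
      fun z => by simp [l]
    have hlift : ∀ s (v : ℝ × EuclideanSpace ℝ (Fin 2)), 0 < v.1 →
        (p e 0 * p (e + 1) 1 - p e 1 * p (e + 1) 0) + l (liftPoint s v) =
          (homOrient (p e) (p (e + 1)) v - c * s) / v.1 := by
      intro s v hv
      rw [hl]
      simp only [liftPoint, homOrient, PiLp.toLp_apply, Matrix.cons_val]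
      field_simp
      ring
    have hge : -(p e 0 * p (e + 1) 1 - p e 1 * p (e + 1) 0) ≤ l z := by
      refine convexHull_min ?_ (convex_halfSpace_ge l.isLinear _) hz
      rintro _ ⟨k, rfl⟩
      refine Fin.addCases (fun i => ?_) (fun j => ?_) k
      · have h1 := hlift 1 (a i) (ha i)
        have h2 : 0 ≤ (homOrient (p e) (p (e + 1)) (a i) - c * 1) / (a i).1 :=
          div_nonneg (by linarith [hi₀ i]) (ha i).le
        rw [hq, Set.mem_ofPred_eq, Fin.append_left]
        linarith
      · have h1 := hlift (-1) (b j) (hb j)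
        have h2 : 0 ≤ (homOrient (p e) (p (e + 1)) (b j) - c * -1) / (b j).1 := by
          have := hedge e i₀ j
          rw [homOrient_add] at this
          exact div_nonneg (by linarith) (hb j).le
        rw [hq, Set.mem_ofPred_eq, Fin.append_right]
        linarith
    rw [hl, hz2] at hge
    rw [← homOrient_one]
    simp only [homOrient, Matrix.cons_val]
    linarith

theorem IsConvexHeptagon.polyDim_lift (hp : IsConvexHeptagon p) (ha : ∀ i, 0 < (a i).1)
    (hb : ∀ j, 0 < (b j).1)
    (hpts : ∀ k, ∃ i j, ∃ t : ℝ, 0 < t ∧ a i + b j = t • ((1 : ℝ), p k)) :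
    polyDim (convexHull ℝ (Set.range
      (Fin.append (fun i => liftPoint 1 (a i)) fun j => liftPoint (-1) (b j)))) = 3 := by
  set q := Fin.append (fun i => liftPoint 1 (a i)) fun j => liftPoint (-1) (b j) with hq
  have htop : vectorSpan ℝ (convexHull ℝ (Set.range q)) = ⊤ := by
    by_contra hne
    obtain ⟨l, hl0, hl⟩ := Submodule.exists_le_ker_of_lt_top _ (lt_top_iff_ne_top.2 hne)
    have hmem := planeInclusion_mem_of_sum ha hb hpts
    have hconst : ∀ z ∈ convexHull ℝ (Set.range q), ∀ w ∈ convexHull ℝ (Set.range q),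
        l z = l w := fun z hz w hw => by
      have := hl (vsub_mem_vectorSpan ℝ hz hw)
      rw [LinearMap.mem_ker, vsub_eq_sub, map_sub] at this
      linarith
    set e : Fin 3 → EuclideanSpace ℝ (Fin 3) := fun i => EuclideanSpace.single i 1
    have hexp : ∀ z, l z = z 0 * l (e 0) + z 1 * l (e 1) + z 2 * l (e 2) := by
      intro z
      have : z = z 0 • e 0 + z 1 • e 1 + z 2 • e 2 := by
        ext i; fin_cases i <;> simp [e]
      conv_lhs => rw [this]
      simp
    have h1 := hconst _ (hmem 1) _ (hmem 0)
    have h2 := hconst _ (hmem 2) _ (hmem 0)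
    have h3 := hconst _ (subset_convexHull ℝ _ ⟨Fin.castAdd 3 0, Fin.append_left _ _ 0⟩) _ (hmem 0)
    have h4 := hp 0 1 2 (by decide) (by decide)
    rw [hexp, hexp (planeInclusion (p 0))] at h1 h2 h3
    simp only [planeInclusion_apply, liftPoint, PiLp.toLp_apply, Matrix.cons_val, zero_mul,
      add_zero] at h1 h2 h3
    unfold orient at h4
    have hl0' : l (e 0) = 0 := by
      have : ((p 1 0 - p 0 0) * (p 2 1 - p 0 1) - (p 1 1 - p 0 1) * (p 2 0 - p 0 0)) *
          l (e 0) = 0 := by linear_combination (p 2 1 - p 0 1) * h1 - (p 1 1 - p 0 1) * h2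
      exact (mul_eq_zero.1 this).resolve_left h4.ne'
    have hl1' : l (e 1) = 0 := by
      have : ((p 1 0 - p 0 0) * (p 2 1 - p 0 1) - (p 1 1 - p 0 1) * (p 2 0 - p 0 0)) *
          l (e 1) = 0 := by linear_combination (p 1 0 - p 0 0) * h2 - (p 2 0 - p 0 0) * h1
      exact (mul_eq_zero.1 this).resolve_left h4.ne'
    have hl2' : l (e 2) = 0 := by
      rw [hl0', hl1'] at h3
      have h5 := ha 0
      simp only [mul_zero, zero_add] at h3
      exact (mul_eq_zero.1 h3).resolve_left (by positivity)
    apply hl0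
    ext z
    rw [hexp, hl0', hl1', hl2']
    simp
  rw [polyDim, htop, finrank_top]
  simp

end Lift

/-! ### The array of sums around a pivot. -/

section Construction

variable {p : Fin 7 → EuclideanSpace ℝ (Fin 2)}

theorem homogeneous_cramer {a b c d : EuclideanSpace ℝ (Fin 2)} (h : orient b c d ≠ 0) :
    ((1 : ℝ), a) = (orient a c d / orient b c d) • ((1 : ℝ), b) -
      (orient a b d / orient b c d) • ((1 : ℝ), c) +
      (orient a b c / orient b c d) • ((1 : ℝ), d) := by
  refine Prod.ext ?_ ?_
  · simp only [Prod.fst_add, Prod.fst_sub, Prod.smul_fst, smul_eq_mul, mul_one]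
    field_simp
    simp only [orient]; ring
  · ext i
    simp only [Prod.snd_add, Prod.snd_sub, Prod.smul_snd, PiLp.add_apply, PiLp.sub_apply,
      PiLp.smul_apply, smul_eq_mul]
    field_simp
    fin_cases i <;> simp only [orient, Fin.zero_eta, Fin.mk_one] <;> ring

/-- The edge vectors of a closed polygon sum to zero, so only the first coordinate survives,
multiplied by twice the area. This turns edge inequalities into positivity of that coordinate. -/
theorem sum_homOrient (p : Fin 7 → EuclideanSpace ℝ (Fin 2))
    (a : ℝ × EuclideanSpace ℝ (Fin 2)) :
    ∑ e, homOrient (p e) (p (e + 1)) a =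
      a.1 * ∑ e, (p e 0 * p (e + 1) 1 - p e 1 * p (e + 1) 0) := by
  have h0 : ∀ i : Fin 2, ∑ e : Fin 7, (p (e + 1) i - p e i) = 0 := fun i => by
    rw [Finset.sum_sub_distrib, sub_eq_zero]
    exact Equiv.sum_comp (Equiv.addRight (1 : Fin 7)) fun e => p e i
  simp only [homOrient, Finset.sum_sub_distrib, Finset.sum_add_distrib, ← Finset.mul_sum,
    ← Finset.sum_mul]
  simp only [Finset.sum_sub_distrib] at h0
  rw [h0, h0]
  ring

theorem IsConvexHeptagon.fst_pos_of_homOrient (hp : IsConvexHeptagon p)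
    {a : ℝ × EuclideanSpace ℝ (Fin 2)} (h : ∀ e, 0 ≤ homOrient (p e) (p (e + 1)) a)
    {e : Fin 7} (he : 0 < homOrient (p e) (p (e + 1)) a) : 0 < a.1 := by
  have key : ∀ {a : ℝ × EuclideanSpace ℝ (Fin 2)} {e : Fin 7},
      (∀ e, 0 ≤ homOrient (p e) (p (e + 1)) a) → 0 < homOrient (p e) (p (e + 1)) a →
      0 < a.1 * ∑ e, (p e 0 * p (e + 1) 1 - p e 1 * p (e + 1) 0) := by
    intro a e h he
    rw [← sum_homOrient]
    exact Finset.sum_pos' (fun e _ => h e) ⟨e, Finset.mem_univ e, he⟩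
  have harea := key (a := (1, p 0)) (e := 1)
    (fun e => by rw [homOrient_one]; exact hp.orient_edge_nonneg 0 e)
    (by rw [homOrient_one]; exact hp.orient_edge_pos (by decide) (by decide))
  rw [one_mul] at harea
  exact pos_of_mul_pos_left (key h he) harea.le

/-- Unlike the pivot inequalities, this holds in every heptagon: the difference of its sides equals
that of `C`, which is the product of two Plücker inequalities with common factors cancelled. The
next lemma is its reflection `i ↦ -i`. -/
theorem IsConvexHeptagon.orient_mul_le_left (hp : IsConvexHeptagon p) :
    orient (p 0) (p 4) (p 5) * orient (p 1) (p 2) (p 3) ≤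
      orient (p 0) (p 2) (p 3) * orient (p 1) (p 4) (p 5) := by
  have p012 := hp 0 1 2 (by decide) (by decide)
  have p013 := hp 0 1 3 (by decide) (by decide)
  have p025 := hp 0 2 5 (by decide) (by decide)
  have p035 := hp 0 3 5 (by decide) (by decide)
  have p015 := hp 0 1 5 (by decide) (by decide)
  have p023 := hp 0 2 3 (by decide) (by decide)
  have p245 := hp 2 4 5 (by decide) (by decide)
  have p345 := hp 3 4 5 (by decide) (by decide)
  have p235 := hp 2 3 5 (by decide) (by decide)
  have p045 := hp 0 4 5 (by decide) (by decide)
  have A : orient (p 0) (p 1) (p 2) * orient (p 0) (p 3) (p 5) ≤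
      orient (p 0) (p 1) (p 3) * orient (p 0) (p 2) (p 5) := by
    rw [orient_mul_orient (p 0) (p 1) (p 2) (p 3) (p 5)]
    have := mul_pos p015 p023
    linarith
  have B : orient (p 0) (p 2) (p 5) * orient (p 3) (p 4) (p 5) ≤
      orient (p 0) (p 3) (p 5) * orient (p 2) (p 4) (p 5) := by
    have e : orient (p 0) (p 3) (p 5) * orient (p 2) (p 4) (p 5) =
        orient (p 0) (p 2) (p 5) * orient (p 3) (p 4) (p 5) +
        orient (p 0) (p 4) (p 5) * orient (p 2) (p 3) (p 5) := by
      simp only [orient]; ring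
    have := mul_pos p045 p235
    linarith
  have C : orient (p 0) (p 1) (p 2) * orient (p 3) (p 4) (p 5) ≤
      orient (p 0) (p 1) (p 3) * orient (p 2) (p 4) (p 5) := by
    have := mul_le_mul A B (by positivity) (by positivity)
    refine le_of_mul_le_mul_left ?_ (mul_pos p025 p035)
    linarith
  have e : orient (p 0) (p 2) (p 3) * orient (p 1) (p 4) (p 5) -
      orient (p 0) (p 4) (p 5) * orient (p 1) (p 2) (p 3) =
      orient (p 0) (p 1) (p 3) * orient (p 2) (p 4) (p 5) -
      orient (p 0) (p 1) (p 2) * orient (p 3) (p 4) (p 5) := by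
    simp only [orient]; ring
  linarith

theorem IsConvexHeptagon.orient_mul_le_right (hp : IsConvexHeptagon p) :
    orient (p 0) (p 2) (p 3) * orient (p 4) (p 5) (p 6) ≤
      orient (p 0) (p 4) (p 5) * orient (p 2) (p 3) (p 6) := by
  have p024 := hp 0 2 4 (by decide) (by decide)
  have p025 := hp 0 2 5 (by decide) (by decide)
  have p026 := hp 0 2 6 (by decide) (by decide)
  have p045 := hp 0 4 5 (by decide) (by decide)
  have p046 := hp 0 4 6 (by decide) (by decide)
  have p023 := hp 0 2 3 (by decide) (by decide)
  have p245 := hp 2 4 5 (by decide) (by decide)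
  have p234 := hp 2 3 4 (by decide) (by decide)
  have A : orient (p 0) (p 5) (p 6) * orient (p 0) (p 2) (p 4) ≤
      orient (p 0) (p 4) (p 6) * orient (p 0) (p 2) (p 5) := by
    have := orient_mul_orient (p 0) (p 2) (p 4) (p 5) (p 6)
    have := mul_pos p026 p045
    linarith
  have B : orient (p 0) (p 2) (p 5) * orient (p 2) (p 3) (p 4) ≤
      orient (p 0) (p 2) (p 4) * orient (p 2) (p 3) (p 5) := by
    have e : orient (p 0) (p 2) (p 4) * orient (p 2) (p 3) (p 5) =
        orient (p 0) (p 2) (p 5) * orient (p 2) (p 3) (p 4) +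
        orient (p 0) (p 2) (p 3) * orient (p 2) (p 4) (p 5) := by
      simp only [orient]; ring
    have := mul_pos p023 p245
    linarith
  have C : orient (p 0) (p 5) (p 6) * orient (p 2) (p 3) (p 4) ≤
      orient (p 0) (p 4) (p 6) * orient (p 2) (p 3) (p 5) := by
    have := mul_le_mul A B (by positivity) (by positivity)
    refine le_of_mul_le_mul_left ?_ (mul_pos p025 p024)
    linarith
  have e : orient (p 0) (p 4) (p 5) * orient (p 2) (p 3) (p 6) -
      orient (p 0) (p 2) (p 3) * orient (p 4) (p 5) (p 6) =
      orient (p 0) (p 4) (p 6) * orient (p 2) (p 3) (p 5) -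
      orient (p 0) (p 5) (p 6) * orient (p 2) (p 3) (p 4) := by
    simp only [orient]; ring
  linarith

/-- If `p 0` is a pivot, the heptagon is the pattern of sums of two triples of vectors. -/
theorem IsConvexHeptagon.exists_lift (hp : IsConvexHeptagon p) (hL : IsLeftPivot p 0)
    (hR : IsRightPivot p 0) : ∃ a b : Fin 3 → ℝ × EuclideanSpace ℝ (Fin 2),
      (∀ i, 0 < (a i).1) ∧ (∀ j, 0 < (b j).1) ∧
      (∀ k, ∃ i j, ∃ t : ℝ, 0 < t ∧ a i + b j = t • ((1 : ℝ), p k)) ∧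
      ∀ e i j, 0 ≤ homOrient (p e) (p (e + 1)) (a i + b j) := by
  have p123 := hp 1 2 3 (by decide) (by decide)
  have p456 := hp 4 5 6 (by decide) (by decide)
  have r1 := homogeneous_cramer (a := p 0) p123.ne'
  have r2 := homogeneous_cramer (a := p 0) p456.ne'
  have hl1 := div_pos (hp 0 2 3 (by decide) (by decide)) p123
  have hl2 := div_pos (hp 0 1 3 (by decide) (by decide)) p123
  have hl3 := div_pos (hp 0 1 2 (by decide) (by decide)) p123
  have hl4 := div_pos (hp 0 5 6 (by decide) (by decide)) p456
  have hl5 := div_pos (hp 0 4 6 (by decide) (by decide)) p456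
  have hl6 := div_pos (hp 0 4 5 (by decide) (by decide)) p456
  -- The four bounds `hU1`, `hU2`, `hV1`, `hV2` treat the edges not settled by signs alone: `1` and
  -- `4` for `u = l4 v4 + l1 v1 - v0`, then `5` and `2` for `w = l6 v6 + l3 v3 - v0`, where `vk =
  -- (1, p k)`. Only `hU1` and `hV1` need the pivot conditions.
  have hU1 : orient (p 1) (p 2) (p 0) ≤
      orient (p 0) (p 5) (p 6) / orient (p 4) (p 5) (p 6) * orient (p 1) (p 2) (p 4) := by
    rw [div_mul_eq_mul_div, le_div_iff₀ p456, orient_rotate]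
    have := hL
    simp only [IsLeftPivot, zero_add] at this
    rwa [orient_rotate (p 0)] at this
  have hU2 : orient (p 4) (p 5) (p 0) ≤
      orient (p 0) (p 2) (p 3) / orient (p 1) (p 2) (p 3) * orient (p 4) (p 5) (p 1) := by
    rw [div_mul_eq_mul_div, le_div_iff₀ p123, orient_rotate (p 0) (p 4) (p 5),
      orient_rotate (p 1) (p 4) (p 5)]
    exact hp.orient_mul_le_left
  have hV1 : orient (p 5) (p 6) (p 0) ≤
      orient (p 0) (p 1) (p 2) / orient (p 1) (p 2) (p 3) * orient (p 5) (p 6) (p 3) := by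
    rw [div_mul_eq_mul_div, le_div_iff₀ p123, orient_rotate (p 3) (p 5) (p 6)]
    have := hR
    simpa only [IsRightPivot, zero_add] using this
  have hV2 : orient (p 2) (p 3) (p 0) ≤
      orient (p 0) (p 4) (p 5) / orient (p 4) (p 5) (p 6) * orient (p 2) (p 3) (p 6) := by
    rw [div_mul_eq_mul_div, le_div_iff₀ p456, orient_rotate]
    exact hp.orient_mul_le_right
  generalize orient (p 0) (p 2) (p 3) / orient (p 1) (p 2) (p 3) = l1 at *
  generalize orient (p 0) (p 1) (p 3) / orient (p 1) (p 2) (p 3) = l2 at *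
  generalize orient (p 0) (p 1) (p 2) / orient (p 1) (p 2) (p 3) = l3 at *
  generalize orient (p 0) (p 5) (p 6) / orient (p 4) (p 5) (p 6) = l4 at *
  generalize orient (p 0) (p 4) (p 6) / orient (p 4) (p 5) (p 6) = l5 at *
  generalize orient (p 0) (p 4) (p 5) / orient (p 4) (p 5) (p 6) = l6 at *
  have s1 : ∀ e, orient (p e) (p (e + 1)) (p 0) = l1 * orient (p e) (p (e + 1)) (p 1) -
      l2 * orient (p e) (p (e + 1)) (p 2) + l3 * orient (p e) (p (e + 1)) (p 3) := fun e => by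
    have := congrArg (homOrient (p e) (p (e + 1))) r1
    simpa only [homOrient_add, homOrient_sub, homOrient_smul, homOrient_one] using this
  have s2 : ∀ e, orient (p e) (p (e + 1)) (p 0) = l4 * orient (p e) (p (e + 1)) (p 4) -
      l5 * orient (p e) (p (e + 1)) (p 5) + l6 * orient (p e) (p (e + 1)) (p 6) := fun e => by
    have := congrArg (homOrient (p e) (p (e + 1))) r2
    simpa only [homOrient_add, homOrient_sub, homOrient_smul, homOrient_one] using this
  have nn : ∀ {l : ℝ}, 0 < l → ∀ e k, 0 ≤ l * orient (p e) (p (e + 1)) (p k) := fun hl e k =>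
    mul_nonneg hl.le (hp.orient_edge_nonneg k e)
  have z1 : ∀ e, orient (p e) (p (e + 1)) (p e) = 0 := fun e => orient_self_outer _ _
  have z2 : ∀ e, orient (p e) (p (e + 1)) (p (e + 1)) = 0 := fun e => orient_self_right _ _
  -- The relations `r1`, `r2` also give `u = l4 v4 + l2 v2 - l3 v3 = l1 v1 + l5 v5 - l6 v6`. For
  -- every edge except `1` and `4`, one of the three forms has its negative term vanish there. The
  -- vector `w` is treated likewise.
  have hu : ∀ e, 0 ≤ homOrient (p e) (p (e + 1))
      (l4 • ((1 : ℝ), p 4) + l1 • ((1 : ℝ), p 1) - ((1 : ℝ), p 0)) := by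
    intro e
    simp only [homOrient_add, homOrient_sub, homOrient_smul, homOrient_one]
    have t1 := s1 e
    have t2 := s2 e
    have m1 := nn hl1 e 1
    have m2 := nn hl2 e 2
    have m4 := nn hl4 e 4
    have y1 := z1 e
    have y2 := z2 e
    fin_cases e <;> simp only [Fin.isValue, Fin.zero_eta, Fin.mk_one, Fin.reduceFinMk, zero_add,
      Fin.reduceAdd] at t1 t2 m1 m2 m4 y1 y2 ⊢ <;> simp only [y1, y2] at t1 t2 m1 m2 m4 ⊢ <;>
      linarith
  have hw : ∀ e, 0 ≤ homOrient (p e) (p (e + 1))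
      (l6 • ((1 : ℝ), p 6) + l3 • ((1 : ℝ), p 3) - ((1 : ℝ), p 0)) := by
    intro e
    simp only [homOrient_add, homOrient_sub, homOrient_smul, homOrient_one]
    have t1 := s1 e
    have t2 := s2 e
    have m3 := nn hl3 e 3
    have m5 := nn hl5 e 5
    have m6 := nn hl6 e 6
    have y1 := z1 e
    have y2 := z2 e
    fin_cases e <;> simp only [Fin.isValue, Fin.zero_eta, Fin.mk_one, Fin.reduceFinMk, zero_add,
      Fin.reduceAdd] at t1 t2 m3 m5 m6 y1 y2 ⊢ <;> simp only [y1, y2] at t1 t2 m3 m5 m6 ⊢ <;>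
      linarith
  have hu1 : 0 < l4 + l1 - 1 := by
    have := hp.fst_pos_of_homOrient hu (e := 0) (by
      simp only [homOrient_add, homOrient_sub, homOrient_smul, homOrient_one, z1]
      have h1 := mul_pos hl4 (hp.orient_edge_pos (i := 4) (k := 0) (by decide) (by decide))
      have h2 := nn hl1 0 1
      linarith)
    simpa using this
  have hw1 : 0 < l6 + l3 - 1 := by
    have := hp.fst_pos_of_homOrient hw (e := 0) (by
      simp only [homOrient_add, homOrient_sub, homOrient_smul, homOrient_one, z1]
      have h1 := mul_pos hl6 (hp.orient_edge_pos (i := 6) (k := 0) (by decide) (by decide))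
      have h2 := nn hl3 0 3
      linarith)
    simpa using this
  have hl : l1 - l2 + l3 = 1 := by
    have := congrArg Prod.fst r1; simpa using this.symm
  have hl' : l4 - l5 + l6 = 1 := by
    have := congrArg Prod.fst r2; simpa using this.symm
  -- Shifting by `s` between the `a i` and the `b j` keeps their sums; `σ` is chosen to make all six
  -- first coordinates positive. The interval is nonempty because `u`, `w`, `l2` and `l5` have
  -- positive weight.
  obtain ⟨σ, hσ1, hσ2⟩ := exists_between
    (show max 0 (max (1 - l6) (1 - l1)) < min 1 (min l3 l4) by
      simp only [max_lt_iff, lt_min_iff]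
      refine ⟨⟨?_, ?_, ?_⟩, ⟨?_, ?_, ?_⟩, ?_, ?_, ?_⟩ <;> linarith)
  simp only [max_lt_iff, lt_min_iff] at hσ1 hσ2
  obtain ⟨h0, h6, h1⟩ := hσ1
  obtain ⟨h1', h3, h4⟩ := hσ2
  set v : Fin 7 → ℝ × EuclideanSpace ℝ (Fin 2) := fun k => ((1 : ℝ), p k) with hv
  set s : ℝ × EuclideanSpace ℝ (Fin 2) := (σ, 0) with hs
  -- With `v0` in the centre, the array `a i + b j` has the rows `l5 v5, l4 v4, u`, then `l6 v6, v0,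
  -- l1 v1`, then `w, l3 v3, l2 v2`.
  set a : Fin 3 → ℝ × EuclideanSpace ℝ (Fin 2) :=
    ![l4 • v 4 - s, v 0 - s, l3 • v 3 - s] with ha
  set b : Fin 3 → ℝ × EuclideanSpace ℝ (Fin 2) :=
    ![l6 • v 6 - v 0 + s, s, l1 • v 1 - v 0 + s] with hb
  have e00 : a 0 + b 0 = l5 • v 5 := by
    have : v 0 = l4 • v 4 - l5 • v 5 + l6 • v 6 := r2
    simp only [ha, hb, Matrix.cons_val]
    rw [this]; abel
  have e01 : a 0 + b 1 = l4 • v 4 := by simp only [ha, hb, Matrix.cons_val]; abel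
  have e02 : a 0 + b 2 = l4 • v 4 + l1 • v 1 - v 0 := by
    simp only [ha, hb, Matrix.cons_val]; abel
  have e10 : a 1 + b 0 = l6 • v 6 := by simp only [ha, hb, Matrix.cons_val]; abel
  have e11 : a 1 + b 1 = (1 : ℝ) • v 0 := by
    simp only [ha, hb, Matrix.cons_val, one_smul]; abel
  have e12 : a 1 + b 2 = l1 • v 1 := by simp only [ha, hb, Matrix.cons_val]; abel
  have e20 : a 2 + b 0 = l6 • v 6 + l3 • v 3 - v 0 := by
    simp only [ha, hb, Matrix.cons_val]; abel
  have e21 : a 2 + b 1 = l3 • v 3 := by simp only [ha, hb, Matrix.cons_val]; abel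
  have e22 : a 2 + b 2 = l2 • v 2 := by
    have : v 0 = l1 • v 1 - l2 • v 2 + l3 • v 3 := r1
    simp only [ha, hb, Matrix.cons_val]
    rw [this]; abel
  have hvertex : ∀ {l : ℝ}, 0 < l → ∀ e k, 0 ≤ homOrient (p e) (p (e + 1)) (l • v k) :=
    fun hl e k => by rw [homOrient_smul, homOrient_one]; exact nn hl e k
  refine ⟨a, b, ?_, ?_, ?_, ?_⟩
  · intro i
    fin_cases i <;> simp [ha, hv, hs] <;> linarith
  · intro j
    fin_cases j <;> simp [hb, hv, hs] <;> linarith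
  · intro k
    fin_cases k
    exacts [⟨1, 1, 1, one_pos, e11⟩, ⟨1, 2, l1, hl1, e12⟩, ⟨2, 2, l2, hl2, e22⟩,
      ⟨2, 1, l3, hl3, e21⟩, ⟨0, 1, l4, hl4, e01⟩, ⟨0, 0, l5, hl5, e00⟩, ⟨1, 0, l6, hl6, e10⟩]
  · intro e i j
    have cases : ∀ i : Fin 3, i = 0 ∨ i = 1 ∨ i = 2 := by decide
    rcases cases i with rfl | rfl | rfl <;> rcases cases j with rfl | rfl | rfl
    · rw [e00]; exact hvertex hl5 e 5
    · rw [e01]; exact hvertex hl4 e 4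
    · rw [e02]; exact hu e
    · rw [e10]; exact hvertex hl6 e 6
    · rw [e11]; exact hvertex one_pos e 0
    · rw [e12]; exact hvertex hl1 e 1
    · rw [e20]; exact hw e
    · rw [e21]; exact hvertex hl3 e 3
    · rw [e22]; exact hvertex hl2 e 2

/-- Every convex heptagon is a section of a three-dimensional polytope spanned by six points. -/
theorem IsConvexHeptagon.exists_isSectionOf (hp : IsConvexHeptagon p) :
    ∃ q : Fin 6 → EuclideanSpace ℝ (Fin 3), polyDim (convexHull ℝ (Set.range q)) = 3 ∧
      IsSectionOf (convexHull ℝ (Set.range p)) (convexHull ℝ (Set.range q)) := by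
  obtain ⟨k, hL, hR⟩ := hp.exists_isLeftPivot_and_isRightPivot
  have hp' := hp.rotate k
  have hrange : Set.range (fun i => p (k + i)) = Set.range p :=
    (Equiv.addLeft k).surjective.range_comp p
  obtain ⟨a, b, ha, hb, hpts, hedge⟩ := hp'.exists_lift
    (by simpa only [IsLeftPivot, zero_add, add_zero] using hL)
    (by simpa only [IsRightPivot, zero_add, add_zero] using hR)
  refine ⟨_, hp'.polyDim_lift ha hb hpts, ?_⟩
  rw [← hrange]
  exact hp'.isSectionOf_lift ha hb hpts hedge

end Construction

/-! ### Assembling the two bounds. -/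

theorem encard_vertexSet_convexHull_range_le {d m : ℕ} (q : Fin m → EuclideanSpace ℝ (Fin d)) :
    (vertexSet (convexHull ℝ (Set.range q))).encard ≤ m := by
  refine (Set.encard_le_encard extremePoints_convexHull_subset).trans ?_
  rw [← Set.image_univ]
  refine (Set.encard_image_le _ _).trans ?_
  simp

/-- The bound `c ≤ n` makes the cardinality finite, so it is a genuine member of `S`; this excludes
the default value `sInf ∅ = 0`. -/
theorem Nat.sInf_eq_of_encard {S : Set ℕ} {n : ℕ} (hle : ∀ m ∈ S, n ≤ m) {c : ℕ∞}
    (hc : ∀ m : ℕ, c = m → m ∈ S) (hcn : c ≤ n) : sInf S = n := by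
  lift c to ℕ using ne_top_of_le_ne_top (ENat.natCast_ne_top n) hcn
  have hmem := hc c rfl
  refine le_antisymm ((Nat.sInf_le hmem).trans (by exact_mod_cast hcn)) ?_
  exact hle _ (Nat.sInf_mem ⟨c, hmem⟩)

theorem theorem3 (P : Set (EuclideanSpace ℝ (Fin 2))) (hP : IsNGon 7 P) :
    intersectionComplexity P = 6 ∧
    extensionComplexity P = 6 ∧
    (∃ Q : Set (EuclideanSpace ℝ (Fin 3)),
      IsPolytope Q ∧ polyDim Q = 3 ∧ (vertexSet Q).encard ≤ 6 ∧ IsSectionOf P Q) ∧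
    (∀ (d : ℕ) (Q : Set (EuclideanSpace ℝ (Fin d))),
      IsPolytope Q → (vertexSet Q).encard ≤ 5 → ¬ IsSectionOf P Q) := by
  obtain ⟨p, hp, rfl⟩ := exists_isConvexHeptagon hP
  obtain ⟨q, hdim, hsec⟩ := hp.exists_isSectionOf
  have hpoly : IsPolytope (convexHull ℝ (Set.range q)) := ⟨_, Set.finite_range q, rfl⟩
  have hcard := encard_vertexSet_convexHull_range_le q
  obtain ⟨W, hW, hfacets⟩ := hsec.exists_isExtensionOf
  refine ⟨?_, ?_, ⟨_, hpoly, hdim, hcard, hsec⟩, ?_⟩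
  · refine Nat.sInf_eq_of_encard ?_ (fun m hm => ⟨_, _, hpoly, hsec, hm⟩) hcard
    rintro m ⟨d, Q, hQ, hs, hm⟩
    have := hp.five_lt_encard_vertexSet hQ hs
    rw [hm] at this
    exact_mod_cast this
  · refine Nat.sInf_eq_of_encard ?_ (fun m hm => ⟨_, _, hW, hm⟩) hfacets
    rintro m ⟨d, Q, hQ, hm⟩
    have := hp.five_lt_encard_facetSet hQ
    rw [hm] at this
    exact_mod_cast this
  · intro d Q hQ hle hs
    exact absurd (hp.five_lt_encard_vertexSet hQ hs) (not_lt.2 hle)
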